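/- **Setting.** A *Frölicher space* is a set $X$ with a class of curves $\mathbb R\to X$ and a class of functions $X\to\mathbb R$ such that the curves are exactly the maps $c$ with $f\circ c\in C^\infty(\mathbb R,\mathbb R)$ for all functions $f$, and the functions are exactly the maps $f$ with $f\circ c\in C^\infty(\mathbb R,\mathbb R)$ for all curves $c$. Smooth maps are the maps that carry curves to curves; they form a cartesian closed category $\mathbf{FS}$, with exponentials $X^Y=\mathcal C^\infty(Y,X)$. The curves of $\mathbb R^n$ are the smooth curves, and $\mathcal C^\infty(\mathbb R^n)=\mathcal C^\infty(\mathbb R^n,\mathbb R)$. A *Weil algebra* is a quotient $W=\mathcal C^\infty(\mathbb R^k)/I$ with $\mathfrak m^r\subseteq I\subseteq\mathfrak m$ for some $r$, where $\mathfrak m$ is the ideal of the functions that vanish at $0$; and $\mathcal C^\infty(\mathbb R^{k_1})/I_1\otimes_\infty\mathcal C^\infty(\mathbb R^{k_2})/I_2=\mathcal C^\infty(\mathbb R^{k_1+k_2})/(I_1,I_2)$. The *Weil prolongation* $X\otimes W$ is the quotient of $\mathcal C^\infty(\mathbb R^k,X)$ by the relation: $f\equiv g$ iff $f(0)=g(0)$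 and $\chi\circ f-\chi\circ g\in I$ for all $\chi\in\mathcal C^\infty(X,\mathbb R)$. It carries the initial Frölicher structure with respect to the maps $X\otimes W\to\mathbb R\otimes W=W$, $[f]\mapsto[\chi\circ f]$, where $W$ is a finite-dimensional real vector space with its standard structure. $X$ is *Weil-exponentiable* if for all Frölicher spaces $Y$ and Weil algebras $W_1,W_2$ there is an isomorphism of Frölicher spaces $(X\otimes W_1)^Y\otimes W_2\cong(X\otimes(W_1\otimes_\infty W_2))^Y$ that is the canonical one: for every smooth $F:\mathbb R^{k_1}\times\mathbb R^{k_2}\times Y\to X$ it takes the class of $b\mapsto(y\mapsto[a\mapsto F(a,b,y)])$ to $y\mapsto[(a,b)\mapsto F(a,b,y)]$. Let $\mathbf{FS}_{\mathbf{WE}}$ be the full subcategory of the Weil-exponentiable spaces. Let $\mathbf D$ be the full subcategory of the category of $\mathcal C^\infty$-rings given by the objects $C=\mathcal C^\infty(\mathbb R^n)\otimes_\infty W$, where $n\in\mathbb N$ and $W=\mathcal C^\infty(\mathbb R^k)/I$ is a Weil algebra. For such $C$ put $X\otimes C=\mathcal C^\infty(\mathbb R^n,X)\otimes W$. A smooth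 map $F:\mathbb R^{n+k}\to X$ determines an element $[F]\in X\otimes C$, the class of $t\mapsto(a\mapsto F(a,t))$. **Standing assumption (the conjecture).** The construction $X\otimes C$, for $X$ in $\mathbf{FS}_{\mathbf{WE}}$, is functorial in $C$, so that it is a bifunctor of $X$ and $C$: every morphism $\varphi:C\to C'$ of $\mathbf D$ acts by a smooth map $X\otimes\varphi:X\otimes C\to X\otimes C'$, with $(X\otimes\varphi)[F]=[F\circ u]$ for every smooth $F$ and every smooth map $u$ of Euclidean spaces that represents $\varphi$ (that is, $\varphi[f]=[f\circ u]$ for all $f$), compatibly with identities and composition, and naturally in $X$. Under this assumption let $\mathbf J:\mathbf{FS}_{\mathbf{WE}}\to\mathbf{Sets}^{\mathbf D}$ be the functor that sends $X$ to the functor $C\mapsto X\otimes C$ (underlying set). **Proposition.** Assume the conjecture. For any Weil-exponentiable Frölicher spaces $X$ and $Y$, the space $X^Y$ is Weil-exponentiable and there is an isomorphism $$\mathbf J(X^Y)\cong\mathbf J(X)^{\mathbf J(Y)}$$ in $\mathbf{Sets}^{\mathbf D}$. It can be chosen canonical: its transpose $\mathbf J(Y)\times\mathbf J(X^Y)\to\mathbf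 J(X)$ is evaluation, that is, for every $C$ in $\mathbf D$ and all smooth $g:\mathbb R^{n+k}\to Y$ and $H:\mathbb R^{n+k}\times Y\to X$ it takes $([g],[p\mapsto H(p,\cdot)])$ to $[p\mapsto H(p,g(p))]$. -/

import Mathlib

open CategoryTheory MonoidalCategory
open scoped ContDiff

universe u v w

/-! ## Frölicher spaces -/

/-- A Frölicher structure on a set: a class of curves and a class of real-valued functions, each
of which consists of everything that composes smoothly with the other class. -/
class Frolicher (X : Type u) where
  curves : Set (ℝ → X)
  functions : Set (X → ℝ)
  mem_curves_iff : ∀ c, c ∈ curves ↔ ∀ f ∈ functions, ContDiff ℝ ∞ (f ∘ c)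
  mem_functions_iff : ∀ f, f ∈ functions ↔ ∀ c ∈ curves, ContDiff ℝ ∞ (f ∘ c)

namespace Frolicher

/-- The Frölicher structure generated by a set of real-valued functions (the initial structure
with respect to them). -/
@[reducible] def ofFunctions {X : Type u} (S : Set (X → ℝ)) : Frolicher X where
  curves := {c | ∀ f ∈ S, ContDiff ℝ ∞ (f ∘ c)}
  functions := {f | ∀ c : ℝ → X, (∀ g ∈ S, ContDiff ℝ ∞ (g ∘ c)) → ContDiff ℝ ∞ (f ∘ c)}
  mem_curves_iff _ := ⟨fun hc _ hf => hf _ hc, fun h f hf => h f (fun _ hc => hc f hf)⟩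
  mem_functions_iff _ := Iff.rfl

/-- The Frölicher structure generated by a set of curves. -/
@[reducible] def ofCurves {X : Type u} (S : Set (ℝ → X)) : Frolicher X where
  curves := {c | ∀ f : X → ℝ, (∀ d ∈ S, ContDiff ℝ ∞ (f ∘ d)) → ContDiff ℝ ∞ (f ∘ c)}
  functions := {f | ∀ c ∈ S, ContDiff ℝ ∞ (f ∘ c)}
  mem_curves_iff _ := Iff.rfl
  mem_functions_iff _ := ⟨fun hf _ hc => hc _ hf, fun h c hc => h c (fun _ hf => hf c hc)⟩

/-- A map between Frölicher spaces is smooth if it carries curves to curves. -/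
def IsSmooth {X : Type u} {Y : Type v} [Frolicher X] [Frolicher Y] (f : X → Y) : Prop :=
  ∀ c ∈ curves (X := X), f ∘ c ∈ curves (X := Y)

/-- The standard structure on the real line. -/
instance : Frolicher ℝ where
  curves := {c | ContDiff ℝ ∞ c}
  functions := {f | ContDiff ℝ ∞ f}
  mem_curves_iff _ := ⟨fun hc _ hf => ContDiff.comp hf hc,
    fun h => h id (show ContDiff ℝ ∞ id from contDiff_id)⟩
  mem_functions_iff _ := ⟨fun hf _ hc => ContDiff.comp hf hc,
    fun h => h id (show ContDiff ℝ ∞ id from contDiff_id)⟩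

/-- The standard structure on `ℝⁿ`: the curves are the smooth curves. By Boman's theorem the
functions are exactly the smooth functions on `ℝⁿ` in the usual sense. -/
instance (n : ℕ) : Frolicher (Fin n → ℝ) where
  curves := {c | ContDiff ℝ ∞ c}
  functions := {f | ∀ c : ℝ → Fin n → ℝ, ContDiff ℝ ∞ c → ContDiff ℝ ∞ (f ∘ c)}
  mem_curves_iff c := ⟨fun hc _ hf => hf c hc, fun h => contDiff_pi.2 fun i =>
    h (fun x => x i) (fun _ hd => contDiff_pi.1 hd i)⟩
  mem_functions_iff _ := Iff.rfl

/-- The product of two Frölicher spaces. -/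
instance (X : Type u) (Y : Type v) [Frolicher X] [Frolicher Y] : Frolicher (X × Y) where
  curves := {c | Prod.fst ∘ c ∈ curves (X := X) ∧ Prod.snd ∘ c ∈ curves (X := Y)}
  functions := {f | ∀ c : ℝ → X × Y, Prod.fst ∘ c ∈ curves (X := X) ∧
    Prod.snd ∘ c ∈ curves (X := Y) → ContDiff ℝ ∞ (f ∘ c)}
  mem_curves_iff c := ⟨fun hc _ hf => hf c hc, fun h =>
    ⟨(mem_curves_iff _).2 fun f hf =>
        h (f ∘ Prod.fst) (fun _ hd => (mem_functions_iff f).1 hf _ hd.1),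
      (mem_curves_iff _).2 fun f hf =>
        h (f ∘ Prod.snd) (fun _ hd => (mem_functions_iff f).1 hf _ hd.2)⟩⟩
  mem_functions_iff _ := Iff.rfl

section Smooth

variable {X : Type u} {Y : Type v} {Z : Type w} [Frolicher X] [Frolicher Y] [Frolicher Z]

theorem const_mem_curves (x : X) : (fun _ => x) ∈ curves (X := X) :=
  (mem_curves_iff _).2 fun _ _ => contDiff_const

theorem IsSmooth.comp {g : Y → Z} {f : X → Y} (hg : IsSmooth g) (hf : IsSmooth f) :
    IsSmooth (g ∘ f) := fun c hc => hg _ (hf c hc)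

theorem isSmooth_id : IsSmooth (id : X → X) := fun _ hc => hc

theorem isSmooth_const (y : Y) : IsSmooth (fun _ : X => y) := fun _ _ => const_mem_curves y

theorem isSmooth_fst : IsSmooth (Prod.fst : X × Y → X) := fun _ hc => hc.1

theorem isSmooth_snd : IsSmooth (Prod.snd : X × Y → Y) := fun _ hc => hc.2

theorem IsSmooth.prodMk {f : X → Y} {g : X → Z} (hf : IsSmooth f) (hg : IsSmooth g) :
    IsSmooth (fun x => (f x, g x)) := fun c hc => ⟨hf c hc, hg c hc⟩

theorem isSmooth_eval {n : ℕ} (i : Fin n) : IsSmooth (fun x : Fin n → ℝ => x i) :=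
  fun c hc => contDiff_pi.1 (show ContDiff ℝ ∞ c from hc) i

theorem isSmooth_pi {n : ℕ} {f : X → Fin n → ℝ} (hf : ∀ i, IsSmooth (fun x => f x i)) :
    IsSmooth f := fun c hc =>
  show ContDiff ℝ ∞ (f ∘ c) from contDiff_pi.2 fun i =>
    show ContDiff ℝ ∞ ((fun x => f x i) ∘ c) from hf i c hc

theorem isSmooth_append {m n : ℕ} {f : X → Fin m → ℝ} {g : X → Fin n → ℝ}
    (hf : IsSmooth f) (hg : IsSmooth g) : IsSmooth (fun x => Fin.append (f x) (g x)) :=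
  isSmooth_pi fun i => by
    refine Fin.addCases (fun j => ?_) (fun j => ?_) i
    · simp only [Fin.append_left]; exact (isSmooth_eval j).comp hf
    · simp only [Fin.append_right]; exact (isSmooth_eval j).comp hg

/-- A smooth map followed by a function is a function. -/
theorem IsSmooth.comp_mem_functions {f : X → Y} (hf : IsSmooth f) {χ : Y → ℝ}
    (hχ : χ ∈ functions (X := Y)) : χ ∘ f ∈ functions (X := X) :=
  (mem_functions_iff _).2 fun c hc => (mem_functions_iff χ).1 hχ _ (hf c hc)

end Smooth

end Frolicher

open Frolicher

/-- The set `C^∞(X, Y)` of smooth maps between Frölicher spaces. -/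
@[ext] structure SmoothMap (X : Type u) (Y : Type v) [Frolicher X] [Frolicher Y] where
  toFun : X → Y
  smooth : IsSmooth toFun

namespace SmoothMap

instance {X : Type u} {Y : Type v} [Frolicher X] [Frolicher Y] :
    CoeFun (SmoothMap X Y) (fun _ => X → Y) := ⟨SmoothMap.toFun⟩

/-- The exponential `Y^X = C^∞(X, Y)`: its structure is generated by the maps `c : ℝ → Y^X` whose
transposes `ℝ × X → Y` are smooth. -/
instance {X : Type u} {Y : Type v} [Frolicher X] [Frolicher Y] : Frolicher (SmoothMap X Y) :=
  ofCurves {c | IsSmooth (fun p : ℝ × X => c p.1 p.2)}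

variable {X : Type u} {Y : Type v} {Z : Type w} [Frolicher X] [Frolicher Y] [Frolicher Z]

def id (X : Type u) [Frolicher X] : SmoothMap X X := ⟨_root_.id, isSmooth_id⟩

def comp (g : SmoothMap Y Z) (f : SmoothMap X Y) : SmoothMap X Z :=
  ⟨g.toFun ∘ f.toFun, g.smooth.comp f.smooth⟩

def prodMk (f : SmoothMap X Y) (g : SmoothMap X Z) : SmoothMap X (Y × Z) :=
  ⟨fun x => (f x, g x), f.smooth.prodMk g.smooth⟩

/-- The transpose `X → Z^Y` of a smooth map `X × Y → Z`. -/
def curry (F : SmoothMap (X × Y) Z) : SmoothMap X (SmoothMap Y Z) where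
  toFun x := ⟨fun y => F (x, y), F.smooth.comp ((isSmooth_const x).prodMk isSmooth_id)⟩
  smooth c hc _ hφ := hφ _ (F.smooth.comp
    (IsSmooth.prodMk
      (IsSmooth.comp (f := Prod.fst) (g := c)
        (fun _ hd => (mem_curves_iff _).2 fun f hf =>
          ((mem_curves_iff c).1 hc f hf).comp hd) isSmooth_fst) isSmooth_snd))

/-- The map `X^Z → Y^Z` given by composition with a smooth map `X → Y`. -/
def postcomp (Z : Type w) [Frolicher Z] (f : SmoothMap X Y) :
    SmoothMap (SmoothMap Z X) (SmoothMap Z Y) where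
  toFun g := f.comp g
  smooth _ hc φ hφ := hc (fun g => φ (f.comp g)) (fun _ hd => hφ _ (f.smooth.comp hd))

end SmoothMap

/-- The category of Frölicher spaces and smooth maps. -/
structure FS : Type (u + 1) where
  carrier : Type u
  [str : Frolicher carrier]

namespace FS

instance : CoeSort FS.{u} (Type u) := ⟨FS.carrier⟩

instance (X : FS.{u}) : Frolicher X := X.str

instance : Category FS.{u} where
  Hom X Y := SmoothMap X Y
  id X := SmoothMap.id X
  comp f g := SmoothMap.comp g f

/-- The exponential `X^Y` of Frölicher spaces. -/
abbrev exp (X Y : FS.{u}) : FS.{u} := ⟨SmoothMap Y X⟩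

end FS

/-! ## Weil algebras -/

/-- The algebra `C^∞(ℝⁿ) = C^∞(ℝⁿ, ℝ)`. -/
def Cinf (n : ℕ) : Subalgebra ℝ ((Fin n → ℝ) → ℝ) where
  carrier := {f | IsSmooth f}
  mul_mem' {f g} hf hg c hc := show ContDiff ℝ ∞ (fun t => f (c t) * g (c t)) from
    ContDiff.mul (show ContDiff ℝ ∞ (f ∘ c) from hf c hc) (show ContDiff ℝ ∞ (g ∘ c) from hg c hc)
  add_mem' {f g} hf hg c hc := show ContDiff ℝ ∞ (fun t => f (c t) + g (c t)) from
    ContDiff.add (show ContDiff ℝ ∞ (f ∘ c) from hf c hc) (show ContDiff ℝ ∞ (g ∘ c) from hg c hc)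
  algebraMap_mem' r := isSmooth_const r

namespace Cinf

/-- The composite of a smooth map `ℝⁿ → X` with a function on `X`. -/
def ofFunction {X : Type u} [Frolicher X] {n : ℕ} (χ : SmoothMap X ℝ)
    (f : SmoothMap (Fin n → ℝ) X) : Cinf n :=
  ⟨χ.toFun ∘ f.toFun, χ.smooth.comp f.smooth⟩

/-- The coordinate functions. -/
def coord {n : ℕ} (i : Fin n) : Cinf n := ⟨fun x => x i, isSmooth_eval i⟩

/-- Precomposition with a smooth map `ℝᵐ → ℝⁿ`. -/
def pullback {m n : ℕ} (p : SmoothMap (Fin m → ℝ) (Fin n → ℝ)) : Cinf n →+* Cinf m where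
  toFun f := ⟨f.1 ∘ p.toFun, IsSmooth.comp f.2 p.smooth⟩
  map_one' := rfl
  map_mul' _ _ := rfl
  map_zero' := rfl
  map_add' _ _ := rfl

/-- The composite `x ↦ f (a₁ x, …, aₙ x)`. -/
def subst {m n : ℕ} (f : Cinf n) (a : Fin n → Cinf m) : Cinf m :=
  ⟨fun x => f.1 (fun i => (a i).1 x),
    IsSmooth.comp (f := fun x i => (a i).1 x) f.2 (isSmooth_pi fun i => (a i).2)⟩

/-- The ideal of functions that vanish at the origin. -/
def maxIdeal (n : ℕ) : Ideal (Cinf n) :=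
  RingHom.ker ((Pi.evalRingHom (fun _ : Fin n → ℝ => ℝ) 0).comp (Cinf n).subtype)

/-- The inclusion of the functions of the first `m` coordinates. -/
def inl (m n : ℕ) : Cinf m →+* Cinf (m + n) :=
  pullback ⟨fun x i => x (Fin.castAdd n i), isSmooth_pi fun _ => isSmooth_eval _⟩

/-- The inclusion of the functions of the last `n` coordinates. -/
def inr (m n : ℕ) : Cinf n →+* Cinf (m + n) :=
  pullback ⟨fun x i => x (Fin.natAdd m i), isSmooth_pi fun _ => isSmooth_eval _⟩

/-- The ideal of `C^∞(ℝ^{m+n})` with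
`C^∞(ℝ^{m+n}) / (I, J) = C^∞(ℝᵐ)/I ⊗_∞ C^∞(ℝⁿ)/J`. -/
def tensorIdeal {m n : ℕ} (I : Ideal (Cinf m)) (J : Ideal (Cinf n)) : Ideal (Cinf (m + n)) :=
  I.map (inl m n) ⊔ J.map (inr m n)

end Cinf

/-- A Weil algebra `C^∞(ℝᵏ)/I`. The two conditions say that `C^∞(ℝᵏ)/I` is a finite-dimensional
local algebra with residue field `ℝ`, the residue map being evaluation at the origin. -/
structure WeilAlgebra where
  gens : ℕ
  ideal : Ideal (Cinf gens)
  le_maxIdeal : ideal ≤ Cinf.maxIdeal gens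
  exists_pow_le : ∃ r : ℕ, Cinf.maxIdeal gens ^ r ≤ ideal

/-! ## Weil prolongations -/

/-- The relation `f ≡ g mod I` on `C^∞(ℝᵏ, X)`. -/
def modSetoid (X : Type u) [Frolicher X] {k : ℕ} (I : Ideal (Cinf k)) :
    Setoid (SmoothMap (Fin k → ℝ) X) where
  r f g := f 0 = g 0 ∧ ∀ χ : SmoothMap X ℝ, Cinf.ofFunction χ f - Cinf.ofFunction χ g ∈ I
  iseqv :=
    { refl := fun f => ⟨rfl, fun χ => by simp⟩
      symm := fun h => ⟨h.1.symm, fun χ => by simpa using I.neg_mem (h.2 χ)⟩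
      trans := fun h h' => ⟨h.1.trans h'.1, fun χ => by simpa using I.add_mem (h.2 χ) (h'.2 χ)⟩ }

/-- The Weil prolongation `X ⊗ (C^∞(ℝᵏ)/I)`. -/
def Prolong (X : Type u) [Frolicher X] {k : ℕ} (I : Ideal (Cinf k)) : Type u :=
  Quotient (modSetoid X I)

namespace Prolong

variable {X : Type u} {Y : Type v} [Frolicher X] [Frolicher Y] {k : ℕ} {I : Ideal (Cinf k)}

/-- The class of `f : ℝᵏ → X`. -/
def mk (I : Ideal (Cinf k)) (f : SmoothMap (Fin k → ℝ) X) : Prolong X I :=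
  Quotient.mk (modSetoid X I) f

/-- The map `χ ⊗ W : X ⊗ W → ℝ ⊗ W = C^∞(ℝᵏ)/I` induced by a function `χ` on `X`. -/
def toQuotient (χ : SmoothMap X ℝ) : Prolong X I → Cinf k ⧸ I :=
  Quotient.lift (fun f => Ideal.Quotient.mk I (Cinf.ofFunction χ f))
    (fun _ _ h => Ideal.Quotient.eq.2 (h.2 χ))

/-- The initial structure with respect to the maps `χ ⊗ W : X ⊗ W → ℝ ⊗ W`, where `ℝ ⊗ W` has the
standard structure of a finite-dimensional real vector space, generated by the linear forms. -/
instance : Frolicher (Prolong X I) :=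
  ofFunctions {g | ∃ (χ : SmoothMap X ℝ) (l : (Cinf k ⧸ I) →ₗ[ℝ] ℝ),
    g = fun q => l (toQuotient χ q)}

theorem modSetoid_comp (φ : SmoothMap X Y) (f g : SmoothMap (Fin k → ℝ) X)
    (h : (modSetoid X I).r f g) : (modSetoid Y I).r (φ.comp f) (φ.comp g) :=
  ⟨congrArg φ.toFun h.1, fun χ => h.2 (χ.comp φ)⟩

/-- The smooth map `φ ⊗ W : X ⊗ W → Y ⊗ W` induced by a smooth map `φ : X → Y`. -/
def map (I : Ideal (Cinf k)) (φ : SmoothMap X Y) : SmoothMap (Prolong X I) (Prolong Y I) where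
  toFun := Quotient.map (fun f => φ.comp f) (modSetoid_comp φ)
  smooth := by
    rintro c hc _ ⟨χ, l, rfl⟩
    have h := hc _ ⟨χ.comp φ, l, rfl⟩
    have e : (fun q : Prolong X I => l (toQuotient (χ.comp φ) q)) =
        fun q => l (toQuotient χ
          (Quotient.map (fun f => φ.comp f) (modSetoid_comp φ) q : Prolong Y I)) := by
      funext q
      induction q using Quotient.ind
      rfl
    rw [e] at h
    exact h

end Prolong

/-! ## Weil exponentiability -/

/-- The smooth map `ℝ^{k₁} → X`, `a ↦ F (a, b, y)`. -/
def sliceAt {X : Type u} {Y : Type v} [Frolicher X] [Frolicher Y] {k₁ k₂ : ℕ}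
    (F : SmoothMap ((Fin (k₁ + k₂) → ℝ) × Y) X) (b : Fin k₂ → ℝ) (y : Y) :
    SmoothMap (Fin k₁ → ℝ) X :=
  ⟨fun a => F (Fin.append a b, y),
    F.smooth.comp ((isSmooth_append isSmooth_id (isSmooth_const b)).prodMk (isSmooth_const y))⟩

/-- The smooth map `ℝᵏ → X`, `x ↦ F (x, y)`. -/
def sliceRight {X : Type u} {Y : Type v} [Frolicher X] [Frolicher Y] {k : ℕ}
    (F : SmoothMap ((Fin k → ℝ) × Y) X) (y : Y) : SmoothMap (Fin k → ℝ) X :=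
  ⟨fun x => F (x, y), F.smooth.comp (isSmooth_id.prodMk (isSmooth_const y))⟩

/-- `X` is Weil-exponentiable: `(X ⊗ W₁)^Y ⊗ W₂ = (X ⊗ (W₁ ⊗_∞ W₂))^Y` for all `Y`, `W₁`, `W₂`.
The equality means that there is an isomorphism of Frölicher spaces, inverse maps being `Φ` and
`Ψ`, that is the canonical one: for every smooth `F : ℝ^{k₁} × ℝ^{k₂} × Y → X` it takes the class
of `b ↦ (y ↦ [a ↦ F (a, b, y)])` to `y ↦ [(a, b) ↦ F (a, b, y)]`. -/
def WeilExponentiable : ObjectProperty FS.{u} := fun X =>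
  ∀ (Y : FS.{u}) (W₁ W₂ : WeilAlgebra),
    ∃ (Φ : SmoothMap (Prolong (SmoothMap Y (Prolong X W₁.ideal)) W₂.ideal)
          (SmoothMap Y (Prolong X (Cinf.tensorIdeal W₁.ideal W₂.ideal))))
      (Ψ : SmoothMap (SmoothMap Y (Prolong X (Cinf.tensorIdeal W₁.ideal W₂.ideal)))
          (Prolong (SmoothMap Y (Prolong X W₁.ideal)) W₂.ideal)),
      Function.LeftInverse Ψ.toFun Φ.toFun ∧ Function.RightInverse Ψ.toFun Φ.toFun ∧
      ∀ (F : SmoothMap ((Fin (W₁.gens + W₂.gens) → ℝ) × Y) X)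
        (G : SmoothMap (Fin W₂.gens → ℝ) (SmoothMap Y (Prolong X W₁.ideal))),
        (∀ b y, G b y = Prolong.mk W₁.ideal (sliceAt F b y)) →
        ∀ y, Φ (Prolong.mk W₂.ideal G) y =
          Prolong.mk (Cinf.tensorIdeal W₁.ideal W₂.ideal) (sliceRight F y)

/-- The full subcategory of Weil-exponentiable Frölicher spaces. -/
abbrev FSWE : Type (u + 1) := (WeilExponentiable.{u}).FullSubcategory

/-! ## `C^∞`-rings and the category `D` -/

/-- A `C^∞`-ring: a set on which the smooth functions `ℝⁿ → ℝ` operate, compatibly with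
projections and composition. -/
structure CinfRing where
  carrier : Type
  op : ∀ {n : ℕ}, Cinf n → (Fin n → carrier) → carrier
  op_coord : ∀ {n : ℕ} (i : Fin n) (a : Fin n → carrier), op (Cinf.coord i) a = a i
  op_subst : ∀ {m n : ℕ} (f : Cinf n) (g : Fin n → Cinf m) (a : Fin m → carrier),
    op (Cinf.subst f g) a = op f (fun i => op (g i) a)

namespace CinfRing

/-- Homomorphisms of `C^∞`-rings. -/
@[ext] structure Hom (A B : CinfRing) where
  toFun : A.carrier → B.carrier
  map_op : ∀ {n : ℕ} (f : Cinf n) (a : Fin n → A.carrier),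
    toFun (A.op f a) = B.op f (fun i => toFun (a i))

/-- The category of `C^∞`-rings. -/
instance : Category CinfRing where
  Hom := Hom
  id A := ⟨fun a => a, fun _ _ => rfl⟩
  comp φ ψ := ⟨fun a => ψ.toFun (φ.toFun a), fun f a => by rw [φ.map_op, ψ.map_op]⟩

/-- The free `C^∞`-ring `C^∞(ℝⁿ)`. -/
def free (n : ℕ) : CinfRing where
  carrier := Cinf n
  op f a := Cinf.subst f a
  op_coord _ _ := rfl
  op_subst _ _ _ := rfl

/-- Congruences on a `C^∞`-ring. -/
structure IsCongruence (A : CinfRing) (r : A.carrier → A.carrier → Prop) : Prop where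
  equivalence : Equivalence r
  op : ∀ {n : ℕ} (f : Cinf n) (a b : Fin n → A.carrier), (∀ i, r (a i) (b i)) →
    r (A.op f a) (A.op f b)

/-- The smallest congruence that contains a given relation. -/
def congruenceGen (A : CinfRing) (s : A.carrier → A.carrier → Prop) :
    A.carrier → A.carrier → Prop :=
  fun a b => ∀ r, IsCongruence A r → (∀ x y, s x y → r x y) → r a b

theorem isCongruence_gen (A : CinfRing) (s : A.carrier → A.carrier → Prop) :
    IsCongruence A (congruenceGen A s) where
  equivalence :=
    { refl := fun a _ hr _ => hr.equivalence.refl a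
      symm := fun h r hr hs => hr.equivalence.symm (h r hr hs)
      trans := fun h h' r hr hs => hr.equivalence.trans (h r hr hs) (h' r hr hs) }
  op f a b h r hr hs := hr.op f a b (fun i => h i r hr hs)

/-- The setoid of the smallest congruence that contains a given relation. -/
def genSetoid (A : CinfRing) (s : A.carrier → A.carrier → Prop) : Setoid A.carrier :=
  ⟨congruenceGen A s, (isCongruence_gen A s).equivalence⟩

/-- The quotient of a `C^∞`-ring by the congruence generated by a relation. -/
noncomputable def quot (A : CinfRing) (s : A.carrier → A.carrier → Prop) : CinfRing where
  carrier := Quotient (genSetoid A s)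
  op f q := Quotient.mk _ (A.op f (fun i => (q i).out))
  op_coord i q := by rw [A.op_coord, Quotient.out_eq]
  op_subst f g q := by
    rw [A.op_subst]
    exact Quotient.sound ((isCongruence_gen A s).op f _ _ fun i =>
      (genSetoid A s).symm (Quotient.mk_out (s := genSetoid A s) _))

/-- The operations on the quotient are computed on representatives. -/
theorem quot_op_mk (A : CinfRing) (s : A.carrier → A.carrier → Prop) {n : ℕ} (f : Cinf n)
    (a : Fin n → A.carrier) :
    (A.quot s).op f (fun i => Quotient.mk (genSetoid A s) (a i)) =
      Quotient.mk (genSetoid A s) (A.op f a) :=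
  Quotient.sound ((isCongruence_gen A s).op f _ _ fun i =>
    Quotient.mk_out (s := genSetoid A s) (a i))

end CinfRing

/-- The objects of `D`: pairs of a natural number `n` and a Weil algebra `W`, standing for
`C^∞(ℝⁿ) ⊗_∞ W`. -/
structure DObj where
  dim : ℕ
  weil : WeilAlgebra

namespace DObj

/-- The `C^∞`-ring `C^∞(ℝⁿ) ⊗_∞ (C^∞(ℝᵏ)/I)`, presented by `n + k` generators and the relations
`f = 0` in the last `k` generators, for `f ∈ I`. -/
noncomputable def ring (C : DObj) : CinfRing :=
  (CinfRing.free (C.dim + C.weil.gens)).quot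
    (fun a b => b = (0 : Cinf _) ∧
      ∃ f ∈ C.weil.ideal, a = Cinf.inr C.dim C.weil.gens f)

/-- The class in `C^∞(ℝⁿ) ⊗_∞ W` of a smooth function on `ℝ^{n+k}`. -/
noncomputable def toRing (C : DObj) (f : Cinf (C.dim + C.weil.gens)) : C.ring.carrier :=
  Quotient.mk _ f

end DObj

/-- The category `D`, the full subcategory of the category of `C^∞`-rings given by the
`C^∞(ℝⁿ) ⊗_∞ W`. -/
abbrev CatD : Type := InducedCategory CinfRing DObj.ring

/-- The number of generators `n + k` of `C^∞(ℝⁿ) ⊗_∞ (C^∞(ℝᵏ)/I)`. -/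
abbrev CatD.gens (C : CatD) : ℕ := DObj.dim C + (DObj.weil C).gens

/-- The smooth map `u : ℝ^{m+l} → ℝ^{n+k}` represents the homomorphism
`φ : C^∞(ℝⁿ) ⊗_∞ W → C^∞(ℝᵐ) ⊗_∞ W'`, i.e. `φ [f] = [f ∘ u]`. -/
def Represents {C C' : CatD} (φ : C ⟶ C')
    (u : SmoothMap (Fin C'.gens → ℝ) (Fin C.gens → ℝ)) : Prop :=
  ∀ f : Cinf C.gens, φ.hom.toFun (DObj.toRing C f) = DObj.toRing C' (Cinf.pullback u f)

/-! ## The prolongation `X ⊗ C` and the functor `J` -/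

/-- `X ⊗ (C^∞(ℝⁿ) ⊗_∞ W) = C^∞(ℝⁿ, X) ⊗ W`. -/
abbrev ProlongD (X : Type u) [Frolicher X] (C : CatD) : Type u :=
  Prolong (SmoothMap (Fin (DObj.dim C) → ℝ) X) (DObj.weil C).ideal

namespace ProlongD

variable {X : Type u} {Y : Type v} [Frolicher X] [Frolicher Y]

/-- The element of `C^∞(ℝⁿ, X) ⊗ W` given by a smooth map `F : ℝ^{n+k} → X`, namely the class of
`t ↦ (a ↦ F (a, t))`. -/
def mk (C : CatD) (F : SmoothMap (Fin C.gens → ℝ) X) : ProlongD X C :=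
  Prolong.mk _ (SmoothMap.curry ⟨fun p : (Fin (DObj.weil C).gens → ℝ) × (Fin (DObj.dim C) → ℝ) =>
    F (Fin.append p.2 p.1), F.smooth.comp (isSmooth_append isSmooth_snd isSmooth_fst)⟩)

/-- The smooth map `f ⊗ C : X ⊗ C → Y ⊗ C` induced by a smooth map `f : X → Y`. -/
def map (C : CatD) (f : SmoothMap X Y) : SmoothMap (ProlongD X C) (ProlongD Y C) :=
  Prolong.map _ (SmoothMap.postcomp _ f)

theorem map_id (C : CatD) (q : ProlongD X C) : map C (SmoothMap.id X) q = q := by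
  induction q using Quotient.ind
  rfl

theorem map_comp {Z : Type w} [Frolicher Z] (C : CatD) (f : SmoothMap X Y) (g : SmoothMap Y Z)
    (q : ProlongD X C) : map C (g.comp f) q = map C g (map C f q) := by
  induction q using Quotient.ind
  rfl

end ProlongD

/-- The content of the conjecture that `X ⊗ C` is functorial in `C`: an action of the morphisms of
`D` on the spaces `X ⊗ C`, for `X` Weil-exponentiable, by smooth maps, which is given on
representatives by substitution, and which makes `(X, C) ↦ X ⊗ C` a bifunctor. -/
structure ProlongationBifunctor where
  act : ∀ (X : FSWE.{u}) {C C' : CatD}, (C ⟶ C') →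
    SmoothMap (ProlongD X.obj C) (ProlongD X.obj C')
  act_mk : ∀ (X : FSWE.{u}) {C C' : CatD} (φ : C ⟶ C')
    (u : SmoothMap (Fin C'.gens → ℝ) (Fin C.gens → ℝ)), Represents φ u →
    ∀ F : SmoothMap (Fin C.gens → ℝ) X.obj,
      act X φ (ProlongD.mk C F) = ProlongD.mk C' (F.comp u)
  act_id : ∀ (X : FSWE.{u}) (C : CatD) (q : ProlongD X.obj C), act X (𝟙 C) q = q
  act_comp : ∀ (X : FSWE.{u}) {C C' C'' : CatD} (φ : C ⟶ C') (ψ : C' ⟶ C'')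
    (q : ProlongD X.obj C), act X (φ ≫ ψ) q = act X ψ (act X φ q)
  act_natural : ∀ {X Y : FSWE.{u}} (f : X ⟶ Y) {C C' : CatD} (φ : C ⟶ C')
    (q : ProlongD X.obj C),
    act Y φ (ProlongD.map C f.hom q) = ProlongD.map C' f.hom (act X φ q)

/-- The functor `J : FS_WE ⥤ Sets^D`, `J(X)(C) = X ⊗ C`. -/
def ProlongationBifunctor.J (T : ProlongationBifunctor.{u}) : FSWE.{u} ⥤ (CatD ⥤ Type u) where
  obj X :=
    { obj := fun C => ProlongD X.obj C
      map := fun φ => ↾(T.act X φ).toFun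
      map_id := fun C => by ext q; exact T.act_id X C q
      map_comp := fun φ ψ => by ext q; exact T.act_comp X φ ψ q }
  map f :=
    { app := fun C => ↾(ProlongD.map C f.hom).toFun
      naturality := fun _ _ φ => by ext q; exact (T.act_natural f φ q).symm }
  map_id X := by ext C q; exact ProlongD.map_id C q
  map_comp f g := by ext C q; exact ProlongD.map_comp C f.hom g.hom q

/-! ### Fourier decay and smoothness of functions of two variables -/

section RealAnalysis

open MeasureTheory Real FourierTransform

/-! Weil exponentiability with `W₁ = ℝ` gives `X^Y ⊗ W ≅ (X ⊗ W)^Y`. Applying this inside and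
outside the hypothesis for the parameter space `Z × Y` gives `(X^Y ⊗ W₁)^Z ⊗ W₂ ≅ (X ⊗ (W₁ ⊗_∞
W₂))^{Z × Y} ≅ (X^Y ⊗ (W₁ ⊗_∞ W₂))^Z`, so `X^Y` is Weil-exponentiable.

For the exponential in `Sets^D`, evaluation `J(Y) × J(X^Y) → J(X)` is shown to be universal: every
natural `θ : J(Y) × F → J(X)` factors through it uniquely. The key is that for `C = C^∞(ℝⁿ) ⊗_∞ W`
the set `X^Y ⊗ C` is the set of smooth maps `ℝⁿ × Y → X ⊗ W`. The values of such a map arise from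
the point morphisms `C → W` and the constant elements of `Y`, which gives uniqueness
(`ev_act_injective`). For existence (`exists_ev_eq`), an element `x` of `F(C)` defines `σ (a, y)` as
`θ` of the constant `y` and the image of `x` under the morphism of the point `a`. Along a curve in
`ℝⁿ × Y` the values of `σ` are the point values of a single element of `X ⊗ (C^∞(ℝ) ⊗_∞ W)`, so `σ`
is smooth and comes from some `q` in `X^Y ⊗ C`. Any morphism `C → C'` factors as a base change `a^*
⊗ W` followed by a morphism through which the given element of `Y ⊗ C'` lifts. By naturality it is
enough to compare `q` with `θ` after base changes, where both sides are determined by their point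
values.

Two foundations are needed. Frölicher spaces are cartesian closed (`isSmooth_evaluation`), which
rests on Boman's theorem in two variables and on a Banach–Steinhaus argument for curves in `C^∞(ℝ,
ℝ)`. Hadamard's lemma with parameters makes the relation `f ≡ g mod I` compatible with maps of
several arguments (`graphComp_sub_mem`) and makes classes of smooth families smooth
(`isSmooth_linear_slice`). -/

theorem iteratedDeriv_eq_zero_of_lt_abs {E : Type*} [NormedAddCommGroup E] [NormedSpace ℝ E]
    {f : ℝ → E} {R : ℝ} (h : ∀ x, R < |x| → f x = 0) (p : ℕ) {x : ℝ} (hx : R < |x|) :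
    iteratedDeriv p f x = 0 := by
  have h0 : f =ᶠ[nhds x] fun _ => 0 := by
    filter_upwards [(isOpen_lt continuous_const continuous_abs).mem_nhds hx] with y hy
    exact h y hy
  rw [h0.iteratedDeriv_eq p]
  simp

theorem norm_integral_le_of_support {f : ℝ → ℂ} {R C : ℝ} (hR : 0 ≤ R)
    (h : ∀ x, R < |x| → f x = 0) (hC : ∀ x, ‖f x‖ ≤ C) : ‖∫ x, f x‖ ≤ 2 * R * C := by
  have hC' : ‖∫ x, f x‖ ≤ ∫ x, (Set.Icc (-R) R).indicator (fun _ => C) x := by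
    refine norm_integral_le_of_norm_le ?_ (Filter.Eventually.of_forall fun x => ?_)
    · exact (integrable_indicator_iff measurableSet_Icc).2 (by simp)
    · by_cases hx : x ∈ Set.Icc (-R) R
      · simpa [hx] using hC x
      · rw [Set.indicator_of_notMem hx, h x (by
          by_contra hh; exact hx (abs_le.1 (not_lt.1 hh)))]
        simp
  refine hC'.trans (le_of_eq ?_)
  rw [integral_indicator measurableSet_Icc]
  rw [setIntegral_const, Real.volume_real_Icc_of_le (by linarith), smul_eq_mul]
  ring

/-- The transform of the `p`-th derivative is `(2πia)^p` times the transform of `f`, and `|a| ≤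
|2πa|`. -/
theorem pow_mul_norm_fourier_le {f : ℝ → ℂ} {R C : ℝ} (hR : 0 ≤ R) (hf : ContDiff ℝ ∞ f)
    (h : ∀ x, R < |x| → f x = 0) (p : ℕ) (hC : ∀ x, ‖iteratedDeriv p f x‖ ≤ C) (a : ℝ) :
    |a| ^ p * ‖𝓕 f a‖ ≤ 2 * R * C := by
  have hint : ∀ n : ℕ, Integrable (iteratedDeriv n f) := fun n => by
    refine (hf.continuous_iteratedDeriv n (by exact_mod_cast le_top)).integrable_of_hasCompactSupport ?_
    refine HasCompactSupport.intro (isCompact_Icc (a := -R) (b := R)) fun x hx => ?_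
    exact iteratedDeriv_eq_zero_of_lt_abs h n (by
      by_contra hh; exact hx (abs_le.1 (not_lt.1 hh)))
  have h1 := congrFun (Real.fourier_iteratedDeriv (N := ⊤) (n := p) hf (fun n _ => hint n) le_top) a
  have h2 : ‖𝓕 (iteratedDeriv p f) a‖ ≤ 2 * R * C := by
    rw [Real.fourier_eq]
    refine norm_integral_le_of_support hR (fun x hx => ?_) fun x => ?_
    · rw [iteratedDeriv_eq_zero_of_lt_abs h p hx, smul_zero]
    · simpa using hC x
  refine le_trans ?_ h2
  rw [h1, norm_smul, norm_pow]
  refine mul_le_mul_of_nonneg_right (pow_le_pow_left₀ (abs_nonneg a) ?_ p) (norm_nonneg _)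
  simp only [norm_mul, Complex.norm_I, Complex.norm_real, Complex.norm_ofNat, norm_eq_abs,
    abs_of_pos pi_pos]
  nlinarith [abs_nonneg a, pi_gt_three]

/-- By Fubini, integrating over `x` first leaves a unimodular factor times a one-variable Fourier
transform, to which the previous bound applies. -/
theorem pow_mul_norm_integral_prod_le {G : ℝ → ℝ → ℂ} {R C : ℝ} (hR : 0 ≤ R)
    (hG : Continuous fun q : ℝ × ℝ => G q.1 q.2) (hf : ∀ y, ContDiff ℝ ∞ fun x => G x y)
    (h : ∀ x y, R < |x| ∨ R < |y| → G x y = 0) (p : ℕ)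
    (hC : ∀ x y, ‖iteratedDeriv p (fun x => G x y) x‖ ≤ C) (a b : ℝ) :
    |a| ^ p * ‖∫ q : ℝ × ℝ, 𝐞 (-(q.1 * a + q.2 * b)) • G q.1 q.2‖ ≤ 2 * R * (2 * R * C) := by
  have hsupp : HasCompactSupport fun q : ℝ × ℝ => 𝐞 (-(q.1 * a + q.2 * b)) • G q.1 q.2 := by
    refine HasCompactSupport.intro ((isCompact_Icc (a := -R) (b := R)).prod
      (isCompact_Icc (a := -R) (b := R))) fun q hq => ?_
    rw [h, smul_zero]
    by_contra hh
    push Not at hh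
    exact hq ⟨abs_le.1 hh.1, abs_le.1 hh.2⟩
  have hcont : Continuous fun q : ℝ × ℝ => 𝐞 (-(q.1 * a + q.2 * b)) • G q.1 q.2 := by
    have : Continuous fun q : ℝ × ℝ => 𝐞 (-(q.1 * a + q.2 * b)) :=
      continuous_fourierChar.comp (by fun_prop)
    exact this.smul hG
  have hint := hcont.integrable_of_hasCompactSupport (μ := volume) hsupp
  rw [Measure.volume_eq_prod] at hint ⊢
  rw [integral_prod_symm _ hint]
  have hin : ∀ y : ℝ, ∫ x, 𝐞 (-(x * a + y * b)) • G x y = 𝐞 (-(y * b)) • 𝓕 (fun x => G x y) a := by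
    intro y
    rw [Real.fourier_eq, Circle.smul_def, ← integral_smul]
    congr 1
    ext x
    rw [← Circle.smul_def, smul_smul, ← AddChar.map_add_eq_mul]
    congr 2
    simp
    ring
  simp only [hin]
  have h0 : ‖((|a| ^ p : ℝ) : ℂ)‖ = |a| ^ p := by
    simp
  rw [← h0, ← norm_smul, ← integral_smul]
  refine norm_integral_le_of_support hR (fun y hy => ?_) fun y => ?_
  · have : (fun x => G x y) = 0 := by ext x; exact h x y (Or.inr hy)
    rw [this, Real.fourier_eq]
    simp
  · rw [norm_smul, h0, Circle.norm_smul]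
    exact pow_mul_norm_fourier_le hR (hf y) (fun x hx => h x y (Or.inl hx)) p (fun x => hC x y) a

/-- Bounds on the pure partials alone make the Fourier transform decay faster than any power, so
Fourier inversion yields full smoothness, mixed derivatives included. The plane is replaced by `ℂ`
because the Fourier transform needs an inner product. -/
theorem contDiff_of_iteratedDeriv_bounded {G : ℝ → ℝ → ℂ} {R : ℝ} (hR : 0 ≤ R)
    (hG : Continuous fun q : ℝ × ℝ => G q.1 q.2)
    (h : ∀ x y, R < |x| ∨ R < |y| → G x y = 0)
    (hf : ∀ y, ContDiff ℝ ∞ fun x => G x y) (hf' : ∀ x, ContDiff ℝ ∞ fun y => G x y)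
    (hC : ∀ p, ∃ C, ∀ x y, ‖iteratedDeriv p (fun x => G x y) x‖ ≤ C)
    (hC' : ∀ p, ∃ C, ∀ x y, ‖iteratedDeriv p (fun y => G x y) y‖ ≤ C) :
    ContDiff ℝ ∞ fun q : ℝ × ℝ => G q.1 q.2 := by
  set f : ℂ → ℂ := fun z => G z.re z.im with hfdef
  have hcont : Continuous f := hG.comp (Complex.continuous_re.prodMk Complex.continuous_im)
  have hint : Integrable f := by
    refine hcont.integrable_of_hasCompactSupport ?_
    refine HasCompactSupport.intro (isCompact_closedBall (0 : ℂ) (2 * R)) fun z hz => h _ _ ?_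
    by_contra hh
    push Not at hh
    apply hz
    rw [mem_closedBall_zero_iff]
    exact (Complex.norm_le_abs_re_add_abs_im z).trans (by linarith)
  have hF : ∀ w : ℂ, 𝓕 f w = ∫ q : ℝ × ℝ, 𝐞 (-(q.1 * w.re + q.2 * w.im)) • G q.1 q.2 := by
    intro w
    rw [Real.fourier_eq, ← Complex.volume_preserving_equiv_real_prod.symm.integral_comp']
    congr 1
    ext q
    have h1 : Complex.measurableEquivRealProd.symm q = ⟨q.1, q.2⟩ := rfl
    have h2 : inner ℝ (⟨q.1, q.2⟩ : ℂ) w = q.1 * w.re + q.2 * w.im := by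
      simp [Complex.inner]
      ring
    rw [h1, h2]
  have hF' : ∀ w : ℂ, 𝓕 f w = ∫ q : ℝ × ℝ, 𝐞 (-(q.1 * w.im + q.2 * w.re)) • G q.2 q.1 := by
    intro w
    rw [hF, Measure.volume_eq_prod, ← integral_prod_swap]
    congr 1
    ext q
    simp only [Prod.fst_swap, Prod.snd_swap]
    rw [add_comm]
  have hB : ∀ p : ℕ, ∃ K, ∀ w : ℂ, ‖w‖ ^ p * ‖𝓕 f w‖ ≤ K := by
    intro p
    obtain ⟨C, hC⟩ := hC p
    obtain ⟨C', hC'⟩ := hC' p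
    refine ⟨2 ^ p * (2 * R * (2 * R * C) + 2 * R * (2 * R * C')), fun w => ?_⟩
    have h1 : |w.re| ^ p * ‖𝓕 f w‖ ≤ 2 * R * (2 * R * C) := by
      rw [hF]
      exact pow_mul_norm_integral_prod_le hR hG hf h p hC _ _
    have h2 : |w.im| ^ p * ‖𝓕 f w‖ ≤ 2 * R * (2 * R * C') := by
      rw [hF']
      exact pow_mul_norm_integral_prod_le (G := fun x y => G y x) hR (hG.comp continuous_swap) hf'
        (fun x y hxy => h _ _ hxy.symm) p (fun x y => hC' y x) _ _
    have h3 : ‖w‖ ^ p ≤ 2 ^ p * (|w.re| ^ p + |w.im| ^ p) := by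
      have h4 : ‖w‖ ≤ 2 * max |w.re| |w.im| := by
        refine (Complex.norm_le_abs_re_add_abs_im w).trans ?_
        linarith [le_max_left |w.re| |w.im|, le_max_right |w.re| |w.im|]
      refine (pow_le_pow_left₀ (norm_nonneg w) h4 p).trans ?_
      rw [mul_pow]
      refine mul_le_mul_of_nonneg_left ?_ (by positivity)
      rcases max_cases |w.re| |w.im| with hh | hh <;> rw [hh.1]
      · linarith [pow_nonneg (abs_nonneg w.im) p]
      · linarith [pow_nonneg (abs_nonneg w.re) p]
    calc ‖w‖ ^ p * ‖𝓕 f w‖ ≤ 2 ^ p * (|w.re| ^ p + |w.im| ^ p) * ‖𝓕 f w‖ :=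
          mul_le_mul_of_nonneg_right h3 (norm_nonneg _)
      _ = 2 ^ p * (|w.re| ^ p * ‖𝓕 f w‖ + |w.im| ^ p * ‖𝓕 f w‖) := by ring
      _ ≤ _ := mul_le_mul_of_nonneg_left (add_le_add h1 h2) (by positivity)
  have hFcont : Continuous (𝓕 f) :=
    VectorFourier.fourierIntegral_continuous continuous_fourierChar
      (by exact continuous_inner) hint
  have hdecay : ∀ p : ℕ, Integrable fun w : ℂ => ‖w‖ ^ p * ‖𝓕 f w‖ := by
    intro p
    obtain ⟨K, hK⟩ := hB p
    -- Since 3 exceeds the real dimension 2 of `ℂ`, three additional powers give an integrable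
    -- majorant.
    obtain ⟨K', hK'⟩ := hB (p + 3)
    have hI : Integrable fun w : ℂ => 8 * (K + K') * (1 + ‖w‖) ^ (-3 : ℝ) := by
      refine (integrable_one_add_norm ?_).const_mul _
      rw [Complex.finrank_real_complex]; norm_num
    refine hI.mono' ?_ (Filter.Eventually.of_forall fun w => ?_)
    · exact (Continuous.mul (by fun_prop) hFcont.norm).aestronglyMeasurable
    · have hw : 0 < 1 + ‖w‖ := by positivity
      rw [Real.norm_of_nonneg (by positivity), rpow_neg hw.le, ← div_eq_mul_inv,
        le_div_iff₀ (by positivity)]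
      have : (1 + ‖w‖) ^ (3 : ℝ) = (1 + ‖w‖) ^ 3 := by norm_cast
      rw [this]
      have h5 : (1 + ‖w‖) ^ 3 ≤ 8 * (1 + ‖w‖ ^ 3) := by
        nlinarith [norm_nonneg w, sq_nonneg (‖w‖ - 1), mul_nonneg (norm_nonneg w) (sq_nonneg (‖w‖ - 1))]
      calc _ ≤ ‖w‖ ^ p * ‖𝓕 f w‖ * (8 * (1 + ‖w‖ ^ 3)) :=
            mul_le_mul_of_nonneg_left h5 (by positivity)
        _ = 8 * (‖w‖ ^ p * ‖𝓕 f w‖ + ‖w‖ ^ (p + 3) * ‖𝓕 f w‖) := by ring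
        _ ≤ _ := mul_le_mul_of_nonneg_left (add_le_add (hK w) (hK' w)) (by norm_num)
  have hsm : ContDiff ℝ ∞ (𝓕 (𝓕 f)) := Real.contDiff_fourier fun n _ => hdecay n
  have hinv : 𝓕⁻ (𝓕 f) = f := hcont.fourierInv_fourier_eq hint (by
    have := hdecay 0
    simp only [pow_zero, one_mul] at this
    exact (integrable_norm_iff hFcont.aestronglyMeasurable).1 this)
  have hfs : ContDiff ℝ ∞ f := by
    rw [← hinv]
    have : 𝓕⁻ (𝓕 f) = fun v => 𝓕 (𝓕 f) (-v) := by
      ext v; exact Real.fourierInv_eq_fourier_neg _ v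
    rw [this]
    exact hsm.comp contDiff_neg
  have : (fun q : ℝ × ℝ => G q.1 q.2) = f ∘ Complex.equivRealProdCLM.symm := by
    ext q; simp [hfdef]
  rw [this]
  exact hfs.comp Complex.equivRealProdCLM.symm.contDiff

/-! ### Cutoffs and locally bounded partial derivatives -/

/-- A smooth cutoff: `1` for `|x| ≤ R` and `0` for `|x| ≥ R + 1`. -/
theorem exists_smooth_cutoff {R : ℝ} (hR : 0 < R) : ∃ β : ℝ → ℝ, ContDiff ℝ ∞ β ∧
    (∀ x, |x| ≤ R → β x = 1) ∧ (∀ x, R + 1 ≤ |x| → β x = 0) ∧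
    ∀ p : ℕ, ∃ C, ∀ x, ‖iteratedFDeriv ℝ p β x‖ ≤ C := by
  let b : ContDiffBump (0 : ℝ) := ⟨R, R + 1, hR, by linarith⟩
  refine ⟨b, b.contDiff, fun x hx => b.one_of_mem_closedBall (by simpa using hx),
    fun x hx => b.zero_of_le_dist (by simpa using hx), fun p => ?_⟩
  have hc : HasCompactSupport (iteratedFDeriv ℝ p b) := b.hasCompactSupport.iteratedFDeriv p
  exact (b.contDiff.continuous_iteratedFDeriv (m := p) (n := ∞)
    (by exact_mod_cast le_top)).bounded_above_of_compact_support hc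

/-- Leibniz's rule inside `[-R, R]`; outside, the product vanishes. The bound is uniform in the
index, which later plays the role of the second variable. -/
theorem exists_bound_iteratedDeriv_mul {β : ℝ → ℝ} (hβ : ContDiff ℝ ∞ β) {R : ℝ}
    (h0 : ∀ x, R ≤ |x| → β x = 0) (hb : ∀ p : ℕ, ∃ C, ∀ x, ‖iteratedFDeriv ℝ p β x‖ ≤ C)
    {ι : Type*} {g : ι → ℝ → ℝ} (hg : ∀ i, ContDiff ℝ ∞ (g i))
    (hC : ∀ p : ℕ, ∃ C, ∀ i x, |x| ≤ R → |iteratedDeriv p (g i) x| ≤ C) (p : ℕ) :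
    ∃ C, ∀ i x, ‖iteratedFDeriv ℝ p (fun x => β x * g i x) x‖ ≤ C := by
  choose B hB using hb
  choose C hC using hC
  refine ⟨∑ j ∈ Finset.range (p + 1), (p.choose j) * |B j| * |C (p - j)|, fun i x => ?_⟩
  by_cases hx : |x| ≤ R
  · refine (norm_iteratedFDeriv_mul_le hβ (hg i) x (n := p) (by exact_mod_cast le_top)).trans ?_
    refine Finset.sum_le_sum fun j _ => ?_
    gcongr
    · exact (hB j x).trans (le_abs_self _)
    · rw [norm_iteratedFDeriv_eq_norm_iteratedDeriv]
      exact (hC (p - j) i x hx).trans (le_abs_self _)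
  · rw [norm_iteratedFDeriv_eq_norm_iteratedDeriv,
      iteratedDeriv_eq_zero_of_lt_abs (fun y hy => by rw [h0 y hy.le, zero_mul]) p (not_le.1 hx)]
    simp only [norm_zero]
    positivity

theorem iteratedDeriv_ofReal {f : ℝ → ℝ} (hf : ContDiff ℝ ∞ f) (p : ℕ) (x : ℝ) :
    iteratedDeriv p (fun x => (f x : ℂ)) x = ((iteratedDeriv p f x : ℝ) : ℂ) := by
  have := Complex.ofRealCLM.iteratedFDeriv_comp_left (hf.contDiffAt (x := x)) (i := p)
    (by exact_mod_cast le_top)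
  have h2 := congrArg (fun m => m (fun _ => (1 : ℝ))) this
  simpa [iteratedDeriv, Function.comp_def] using h2

/-- A function of two variables whose pure partial derivatives of all orders are locally bounded
is smooth. -/
theorem contDiff_of_locally_bounded_partials {g : ℝ → ℝ → ℝ} (hf : ∀ y, ContDiff ℝ ∞ fun x => g x y)
    (hf' : ∀ x, ContDiff ℝ ∞ fun y => g x y)
    (hC : ∀ (p : ℕ) (R : ℝ), ∃ C, ∀ x y, |x| ≤ R → |y| ≤ R →
      |iteratedDeriv p (fun x => g x y) x| ≤ C)
    (hC' : ∀ (p : ℕ) (R : ℝ), ∃ C, ∀ x y, |x| ≤ R → |y| ≤ R →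
      |iteratedDeriv p (fun y => g x y) y| ≤ C) :
    ContDiff ℝ ∞ fun q : ℝ × ℝ => g q.1 q.2 := by
  -- Smoothness is local, so `g` may be multiplied by a cutoff in each variable.
  suffices h : ∀ R : ℝ, 0 < R → ∃ g' : ℝ × ℝ → ℝ, ContDiff ℝ ∞ g' ∧
      ∀ q : ℝ × ℝ, |q.1| ≤ R → |q.2| ≤ R → g q.1 q.2 = g' q by
    refine contDiff_iff_contDiffAt.2 fun q => ?_
    obtain ⟨g', hg', hq⟩ := h (|q.1| + |q.2| + 1) (by positivity)
    refine hg'.contDiffAt.congr_of_eventuallyEq ?_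
    have h1 : ∀ᶠ r : ℝ × ℝ in nhds q, |r.1| < |q.1| + |q.2| + 1 :=
      (continuous_fst.abs.continuousAt).eventually_lt continuousAt_const (by
        linarith [abs_nonneg q.2])
    have h2 : ∀ᶠ r : ℝ × ℝ in nhds q, |r.2| < |q.1| + |q.2| + 1 :=
      (continuous_snd.abs.continuousAt).eventually_lt continuousAt_const (by
        linarith [abs_nonneg q.1])
    filter_upwards [h1, h2] with r hr1 hr2 using hq r hr1.le hr2.le
  intro R hR
  obtain ⟨β, hβ, hβ1, hβ0, hβb⟩ := exists_smooth_cutoff hR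
  have hR' : 0 ≤ R + 1 := by linarith
  have hβle : ∃ B, 0 ≤ B ∧ ∀ x, |β x| ≤ B := by
    obtain ⟨B, hB⟩ := hβb 0
    exact ⟨|B|, abs_nonneg _, fun x => by simpa using (hB x).trans (le_abs_self _)⟩
  obtain ⟨B, hB0, hB⟩ := hβle
  have bound : ∀ (f : ℝ → ℝ → ℝ), (∀ y, ContDiff ℝ ∞ fun x => f x y) →
      (∀ (p : ℕ) (R : ℝ), ∃ C, ∀ x y, |x| ≤ R → |y| ≤ R → |iteratedDeriv p (fun x => f x y) x| ≤ C) →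
      ∀ p : ℕ, ∃ C, ∀ x y, |iteratedDeriv p (fun x => β x * (β y * f x y)) x| ≤ C := by
    intro f hf hC p
    obtain ⟨C, hC⟩ := exists_bound_iteratedDeriv_mul (ι := Set.Icc (-(R + 1)) (R + 1)) hβ hβ0 hβb
      (g := fun y x => f x y) (fun y => hf y) (fun p => by
        obtain ⟨C, hC⟩ := hC p (R + 1)
        exact ⟨C, fun i x hx => hC x i hx (abs_le.2 i.2)⟩) p
    refine ⟨B * |C|, fun x y => ?_⟩
    by_cases hy : |y| ≤ R + 1
    · have h1 : (fun x => β x * (β y * f x y)) = fun x => β y * (β x * f x y) := by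
        ext x; ring
      rw [h1, iteratedDeriv_const_mul_field, abs_mul]
      refine mul_le_mul (hB y) ?_ (abs_nonneg _) hB0
      have h2 := hC ⟨y, abs_le.1 hy⟩ x
      rw [norm_iteratedFDeriv_eq_norm_iteratedDeriv] at h2
      exact h2.trans (le_abs_self _)
    · have h1 : (fun x => β x * (β y * f x y)) = fun x => 0 := by
        ext x; rw [hβ0 y (not_le.1 hy).le]; ring
      rw [h1]
      simp
      positivity
  have lip : ∀ (f : ℝ → ℝ → ℝ), (∀ y, ContDiff ℝ ∞ fun x => f x y) →
      (∀ p : ℕ, ∃ C, ∀ x y, |iteratedDeriv p (fun x => f x y) x| ≤ C) →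
      ∃ C : ℝ, ∀ x x' y, |f x y - f x' y| ≤ C * |x - x'| := by
    intro f hf hC
    obtain ⟨C, hC⟩ := hC 1
    refine ⟨C, fun x x' y => ?_⟩
    have := Convex.norm_image_sub_le_of_norm_deriv_le (f := fun x => f x y) (s := Set.univ)
      (C := C) (x := x') (y := x)
      (fun z _ => ((hf y).differentiable (by simp)).differentiableAt) (fun z _ => by
        simpa using hC z y) convex_univ trivial trivial
    simpa using this
  set G : ℝ → ℝ → ℝ := fun x y => β x * (β y * g x y) with hGdef
  have hG1 : ∀ y, ContDiff ℝ ∞ fun x => G x y := fun y => hβ.mul (contDiff_const.mul (hf y))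
  have hG2 : ∀ x, ContDiff ℝ ∞ fun y => G x y := fun x => contDiff_const.mul (hβ.mul (hf' x))
  have hb1 := bound g hf hC
  have hb2 := bound (fun y x => g x y) hf' (fun p R => by
    obtain ⟨C, h⟩ := hC' p R
    exact ⟨C, fun x y hx hy => h y x hy hx⟩)
  have hb2' : ∀ p : ℕ, ∃ C, ∀ y x, |iteratedDeriv p (fun y => G x y) y| ≤ C := by
    intro p
    obtain ⟨C, h⟩ := hb2 p
    refine ⟨C, fun y x => ?_⟩
    convert h y x using 3
    ext y
    simp only [hGdef]
    ring
  -- Uniform Lipschitz bounds in each variable separately give joint continuity.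
  have hGc : Continuous fun q : ℝ × ℝ => G q.1 q.2 := by
    obtain ⟨C1, h1⟩ := lip G hG1 hb1
    obtain ⟨C2, h2⟩ := lip (fun y x => G x y) hG2 hb2'
    refine continuous_iff_continuousAt.2 fun q => ?_
    have hlim : Filter.Tendsto (fun r : ℝ × ℝ => C1 * |r.1 - q.1| + C2 * |r.2 - q.2|) (nhds q)
        (nhds 0) := by
      have : Continuous fun r : ℝ × ℝ => C1 * |r.1 - q.1| + C2 * |r.2 - q.2| := by fun_prop
      simpa using this.tendsto q
    refine tendsto_iff_norm_sub_tendsto_zero.2 (squeeze_zero (fun _ => norm_nonneg _)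
      (fun r => ?_) hlim)
    calc ‖G r.1 r.2 - G q.1 q.2‖ = |(G r.1 r.2 - G q.1 r.2) + (G q.1 r.2 - G q.1 q.2)| := by
          rw [Real.norm_eq_abs]; congr 1; ring
      _ ≤ _ := (abs_add_le _ _).trans (add_le_add (h1 _ _ _) (h2 _ _ _))
  have key := contDiff_of_iteratedDeriv_bounded (G := fun x y => (G x y : ℂ)) hR'
    (Complex.continuous_ofReal.comp hGc) (fun x y hxy => by
      rcases hxy with hx | hy
      · simp [hGdef, hβ0 x hx.le]
      · simp [hGdef, hβ0 y hy.le])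
    (fun y => Complex.ofRealCLM.contDiff.comp (hG1 y))
    (fun x => Complex.ofRealCLM.contDiff.comp (hG2 x))
    (fun p => by
      obtain ⟨C, h⟩ := hb1 p
      refine ⟨C, fun x y => ?_⟩
      rw [iteratedDeriv_ofReal (hG1 y)]
      simpa using h x y)
    (fun p => by
      obtain ⟨C, h⟩ := hb2' p
      refine ⟨C, fun x y => ?_⟩
      rw [iteratedDeriv_ofReal (hG2 x)]
      simpa using h y x)
  refine ⟨fun q => G q.1 q.2, ?_, fun q h1 h2 => ?_⟩
  · exact Complex.reCLM.contDiff.comp key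
  · simp [hGdef, hβ1 _ h1, hβ1 _ h2]

/-! ### Special curves and Boman's theorem -/

/-- The number `δ n` is so small that all derivatives of order at most `n` of the `n`-th term are
bounded by `2⁻ⁿ`. For each order only finitely many terms escape this bound, so every derived series
converges uniformly. -/
theorem exists_pos_contDiff_tsum_mul {w : ℕ → ℝ → ℝ} (hw : ∀ n, ContDiff ℝ ∞ (w n))
    (hc : ∀ n, HasCompactSupport (w n)) : ∃ δ : ℕ → ℝ, (∀ n, 0 < δ n) ∧
      ∀ y : ℕ → ℝ, (∀ n, |y n| ≤ δ n) → ContDiff ℝ ∞ fun x => ∑' n, y n * w n x := by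
  have hb : ∀ n k : ℕ, ∃ C, ∀ x, ‖iteratedFDeriv ℝ k (w n) x‖ ≤ C := fun n k =>
    ((hw n).continuous_iteratedFDeriv (m := k) (n := ∞)
      (by exact_mod_cast le_top)).bounded_above_of_compact_support ((hc n).iteratedFDeriv k)
  choose B hB using hb
  have hpos : ∀ n, 0 < 1 + ∑ k ∈ Finset.range (n + 1), |B n k| := fun n => by positivity
  refine ⟨fun n => (1 / 2) ^ n / (1 + ∑ k ∈ Finset.range (n + 1), |B n k|),
    fun n => div_pos (by positivity) (hpos n), fun y hy => ?_⟩
  refine contDiff_tsum_of_eventually (N := ⊤) (v := fun _ n => (1 / 2) ^ n)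
    (fun n => contDiff_const.mul (hw n)) (fun k _ => summable_geometric_two) fun k _ => ?_
  rw [Nat.cofinite_eq_atTop]
  filter_upwards [Filter.eventually_ge_atTop k] with n hn x
  have h1 : iteratedFDeriv ℝ k (fun x => y n * w n x) x = y n • iteratedFDeriv ℝ k (w n) x := by
    change iteratedFDeriv ℝ k (y n • w n) x = _
    exact iteratedFDeriv_const_smul_apply (((hw n).of_le (by exact_mod_cast le_top)).contDiffAt)
  rw [h1, norm_smul, norm_eq_abs]
  have h2 : ‖iteratedFDeriv ℝ k (w n) x‖ ≤ 1 + ∑ k ∈ Finset.range (n + 1), |B n k| := by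
    refine (hB n k x).trans ((le_abs_self _).trans ?_)
    have := Finset.single_le_sum (f := fun k => |B n k|) (fun i _ => abs_nonneg _)
      (Finset.mem_range.2 (Nat.lt_succ_of_le hn))
    linarith
  calc |y n| * ‖iteratedFDeriv ℝ k (w n) x‖
      ≤ (1 / 2) ^ n / (1 + ∑ k ∈ Finset.range (n + 1), |B n k|) *
        (1 + ∑ k ∈ Finset.range (n + 1), |B n k|) := by
        refine mul_le_mul (hy n) h2 (norm_nonneg _) ?_
        exact (div_pos (by positivity) (hpos n)).le
    _ = (1 / 2) ^ n := div_mul_cancel₀ _ (hpos n).ne'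

/-- The special curve lemma: a smooth curve passes through the points of a rapidly convergent
sequence along prescribed line segments, whose velocities decrease rapidly as well. -/
theorem exists_special_curve : ∃ δ : ℕ → ℝ, (∀ n, 0 < δ n) ∧
    ∀ y e : ℕ → ℝ, (∀ n, |y n| ≤ δ n) → (∀ n, |e n| ≤ δ n) → ∃ c : ℝ → ℝ, ContDiff ℝ ∞ c ∧
      ∀ n : ℕ, ∀ᶠ x in nhds ((1 / 2 : ℝ) ^ n), c x = y n + e n * (x - (1 / 2) ^ n) := by
  let b : ContDiffBump (0 : ℝ) := ⟨1 / 8, 1 / 4, by norm_num, by norm_num⟩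
  -- The `n`-th bump lives within `2⁻ⁿ/4` of `2⁻ⁿ` and equals 1 within `2⁻ⁿ/8`, so the supports do
  -- not interfere.
  set β : ℕ → ℝ → ℝ := fun n x => b (2 ^ n * x - 1) with hβ
  have h2 : ∀ n : ℕ, (2 : ℝ) ^ n * (1 / 2) ^ n = 1 := fun n => by
    rw [← mul_pow]; norm_num
  have hβs : ∀ n, ContDiff ℝ ∞ (β n) := fun n =>
    b.contDiff.comp ((contDiff_const.mul contDiff_id).sub contDiff_const)
  have hβc : ∀ n, HasCompactSupport (β n) := fun n => by
    refine HasCompactSupport.intro (isCompact_Icc (a := -2) (b := 2)) fun x hx =>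
      b.zero_of_le_dist ?_
    rw [dist_zero_right, norm_eq_abs]
    show (1 / 4 : ℝ) ≤ _
    have hx' : 2 < |x| := by
      by_contra hh; exact hx (abs_le.1 (not_lt.1 hh))
    have h1 : (1 : ℝ) ≤ 2 ^ n := one_le_pow₀ (by norm_num)
    have h3 : |(2 : ℝ) ^ n * x| - |1| ≤ |2 ^ n * x - 1| := abs_sub_abs_le_abs_sub _ _
    rw [abs_mul, abs_of_pos (by positivity : (0 : ℝ) < 2 ^ n), abs_one] at h3
    nlinarith
  have hβ' : ∀ n, ∀ᶠ x in nhds ((1 / 2 : ℝ) ^ n), β n x = 1 ∧ ∀ m, m ≠ n → β m x = 0 := by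
    intro n
    have h1 : ∀ᶠ x in nhds ((1 / 2 : ℝ) ^ n), |2 ^ n * x - 1| < 1 / 8 := by
      have : Continuous fun x : ℝ => |2 ^ n * x - 1| := by fun_prop
      refine this.continuousAt.eventually_lt continuousAt_const ?_
      rw [h2]; norm_num
    filter_upwards [h1] with x hx
    refine ⟨b.one_of_mem_closedBall (mem_closedBall_zero_iff.2 hx.le),
      fun m hm => b.zero_of_le_dist ?_⟩
    rw [dist_zero_right, norm_eq_abs]
    show (1 / 4 : ℝ) ≤ _
    rw [abs_lt] at hx
    rcases lt_or_gt_of_ne hm with h | h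
    · obtain ⟨k, rfl⟩ := Nat.exists_eq_add_of_lt h
      have h4 : (2 : ℝ) ^ (m + k + 1) * x = 2 ^ m * x * (2 * 2 ^ k) := by ring
      have h5 : (1 : ℝ) ≤ 2 ^ k := one_le_pow₀ (by norm_num)
      rw [h4] at hx
      rw [abs_sub_comm]
      refine le_trans ?_ (le_abs_self _)
      by_contra hh
      push Not at hh
      nlinarith
    · obtain ⟨k, rfl⟩ := Nat.exists_eq_add_of_lt h
      have h4 : (2 : ℝ) ^ (n + k + 1) * x = 2 ^ n * x * (2 * 2 ^ k) := by ring
      have h5 : (1 : ℝ) ≤ 2 ^ k := one_le_pow₀ (by norm_num)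
      rw [h4]
      refine le_trans ?_ (le_abs_self _)
      nlinarith
  obtain ⟨δ, hδ, H⟩ := exists_pos_contDiff_tsum_mul hβs hβc
  obtain ⟨δ', hδ', H'⟩ := exists_pos_contDiff_tsum_mul (w := fun n x => β n x * (x - (1 / 2) ^ n))
    (fun n => (hβs n).mul (contDiff_id.sub contDiff_const)) (fun n => (hβc n).mul_right)
  refine ⟨fun n => min (δ n) (δ' n), fun n => lt_min (hδ n) (hδ' n), fun y e hy he =>
    ⟨_, (H y fun n => (hy n).trans (min_le_left _ _)).add
      (H' e fun n => (he n).trans (min_le_right _ _)), fun n => ?_⟩⟩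
  filter_upwards [hβ' n] with x hx
  rw [tsum_eq_single n (fun m hm => by rw [hx.2 m hm, mul_zero]),
    tsum_eq_single n (fun m hm => by rw [hx.2 m hm, zero_mul, mul_zero]), hx.1]
  ring

/-- If the `p`-th partial is unbounded near `q`, there are points `r n` within `δ n` of `q` where it
exceeds `n / δ n ^ p`. A special curve through them with horizontal velocity `δ n` multiplies it by
`δ n ^ p`, so the `p`-th derivative along the curve exceeds `n` at time `2⁻ⁿ`. This contradicts its
continuity on `[0, 1]`. -/
theorem locally_bounded_iteratedDeriv_of_curves {g : ℝ → ℝ → ℝ}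
    (hg : ∀ c d : ℝ → ℝ, ContDiff ℝ ∞ c → ContDiff ℝ ∞ d → ContDiff ℝ ∞ fun t => g (c t) (d t))
    (p : ℕ) (R : ℝ) :
    ∃ C, ∀ x y, |x| ≤ R → |y| ≤ R → |iteratedDeriv p (fun x => g x y) x| ≤ C := by
  suffices h : ∃ C, ∀ q ∈ Set.Icc (-R) R ×ˢ Set.Icc (-R) R,
      |iteratedDeriv p (fun x => g x q.2) q.1| ≤ C by
    obtain ⟨C, hC⟩ := h
    exact ⟨C, fun x y hx hy => hC (x, y) ⟨abs_le.1 hx, abs_le.1 hy⟩⟩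
  refine IsCompact.induction_on (p := fun s : Set (ℝ × ℝ) => ∃ C, ∀ q ∈ s,
    |iteratedDeriv p (fun x => g x q.2) q.1| ≤ C) (isCompact_Icc.prod isCompact_Icc) ⟨0, by simp⟩
    (fun s t hst ⟨C, hC⟩ => ⟨C, fun q hq => hC q (hst hq)⟩)
    (fun s t ⟨C, hC⟩ ⟨C', hC'⟩ => ⟨max C C', fun q hq => ?_⟩) fun q _ => ?_
  · rcases hq with hq | hq
    · exact (hC q hq).trans (le_max_left _ _)
    · exact (hC' q hq).trans (le_max_right _ _)
  by_contra hcon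
  push Not at hcon
  obtain ⟨δ, hδ, H⟩ := exists_special_curve
  have hx : ∀ n : ℕ, ∃ r : ℝ × ℝ, |r.1 - q.1| ≤ δ n ∧ |r.2 - q.2| ≤ δ n ∧
      n / δ n ^ p < |iteratedDeriv p (fun x => g x r.2) r.1| := by
    intro n
    obtain ⟨r, hr, hr'⟩ := hcon (Metric.closedBall q (δ n))
      (mem_nhdsWithin_of_mem_nhds (Metric.closedBall_mem_nhds q (hδ n))) (n / δ n ^ p)
    rw [Metric.mem_closedBall, Prod.dist_eq] at hr
    exact ⟨r, (le_max_left _ _).trans hr, (le_max_right _ _).trans hr, hr'⟩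
  choose r hr1 hr2 hr using hx
  obtain ⟨c, hc, hc'⟩ := H (fun n => (r n).1 - q.1) δ hr1 (fun n => (abs_of_pos (hδ n)).le)
  -- Zero velocity in the second coordinate, so that near time `2⁻ⁿ` only the first variable of `g`
  -- moves.
  obtain ⟨d, hd, hd'⟩ := H (fun n => (r n).2 - q.2) 0 hr2 (fun n => by simpa using (hδ n).le)
  have hs := hg (fun t => q.1 + c t) (fun t => q.2 + d t) (contDiff_const.add hc)
    (contDiff_const.add hd)
  obtain ⟨K, hK⟩ := (isCompact_Icc (a := (0 : ℝ)) (b := 1)).exists_bound_of_continuousOn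
    (hs.continuous_iteratedDeriv p (by exact_mod_cast le_top)).continuousOn
  obtain ⟨n, hn⟩ := exists_nat_gt K
  have h1 := hK ((1 / 2) ^ n) ⟨by positivity, pow_le_one₀ (by norm_num) (by norm_num)⟩
  have h2 : (fun t => g (q.1 + c t) (q.2 + d t)) =ᶠ[nhds ((1 / 2 : ℝ) ^ n)]
      fun t => g (δ n * t + ((r n).1 - δ n * (1 / 2) ^ n)) (r n).2 := by
    filter_upwards [hc' n, hd' n] with t ht ht'
    rw [ht, ht']
    congr 1
    · ring
    · simp
  rw [h2.iteratedDeriv_eq p] at h1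
  have h3 := congrFun (iteratedDeriv_comp_const_mul (n := p)
    (f := fun z => g (z + ((r n).1 - δ n * (1 / 2) ^ n)) (r n).2)
    ((hg (fun z => z + ((r n).1 - δ n * (1 / 2) ^ n)) (fun _ => (r n).2) (by fun_prop)
      (by fun_prop)).of_le (by exact_mod_cast le_top)) (δ n)) ((1 / 2) ^ n)
  rw [h3] at h1
  have h4 := congrFun (iteratedDeriv_comp_add_const p (fun z => g z (r n).2)
    ((r n).1 - δ n * (1 / 2) ^ n)) (δ n * (1 / 2) ^ n)
  rw [h4] at h1
  rw [norm_mul, norm_pow, norm_eq_abs, norm_eq_abs, abs_of_pos (hδ n), add_sub_cancel] at h1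
  have h5 := hr n
  rw [div_lt_iff₀ (pow_pos (hδ n) p), mul_comm] at h5
  linarith

/-- **Boman's theorem** in two variables. -/
theorem contDiff_of_contDiff_along_curves {g : ℝ → ℝ → ℝ}
    (hg : ∀ c d : ℝ → ℝ, ContDiff ℝ ∞ c → ContDiff ℝ ∞ d → ContDiff ℝ ∞ fun t => g (c t) (d t)) :
    ContDiff ℝ ∞ fun q : ℝ × ℝ => g q.1 q.2 :=
  contDiff_of_locally_bounded_partials
    (fun y => hg (fun x => x) (fun _ => y) contDiff_id contDiff_const)
    (fun x => hg (fun _ => x) (fun y => y) contDiff_const contDiff_id)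
    (locally_bounded_iteratedDeriv_of_curves hg) fun p R => by
      obtain ⟨C, hC⟩ := locally_bounded_iteratedDeriv_of_curves (g := fun y x => g x y)
        (fun c d hc hd => hg d c hd hc) p R
      exact ⟨C, fun x y hx hy => hC y x hy hx⟩

/-! ### Curves in `C^∞(ℝ, ℝ)` -/

theorem contDiff_uncurry_deriv {g : ℝ → ℝ → ℝ} (hg : ContDiff ℝ ∞ fun q : ℝ × ℝ => g q.1 q.2) :
    ContDiff ℝ ∞ fun q : ℝ × ℝ => deriv (fun x => g x q.2) q.1 := by
  have h : (fun q : ℝ × ℝ => deriv (fun x => g x q.2) q.1) =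
      fun q : ℝ × ℝ => fderiv ℝ (fun q : ℝ × ℝ => g q.1 q.2) q (1, 0) := by
    ext q
    have h1 : HasDerivAt (fun x : ℝ => (x, q.2)) ((1 : ℝ), (0 : ℝ)) q.1 :=
      (hasDerivAt_id q.1).prodMk (hasDerivAt_const q.1 q.2)
    have h2 : HasFDerivAt (fun q : ℝ × ℝ => g q.1 q.2) (fderiv ℝ (fun q : ℝ × ℝ => g q.1 q.2) q)
        (q.1, q.2) := (hg.differentiable (by simp)).differentiableAt.hasFDerivAt
    exact (h2.comp_hasDerivAt q.1 h1).deriv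
  rw [h]
  exact (hg.fderiv_right (m := ∞) (by simp)).clm_apply contDiff_const

theorem contDiff_uncurry_iteratedDeriv {g : ℝ → ℝ → ℝ}
    (hg : ContDiff ℝ ∞ fun q : ℝ × ℝ => g q.1 q.2) (p : ℕ) :
    ContDiff ℝ ∞ fun q : ℝ × ℝ => iteratedDeriv p (fun x => g x q.2) q.1 := by
  induction p with
  | zero => simpa using hg
  | succ p ih =>
    simp only [iteratedDeriv_succ]
    exact contDiff_uncurry_deriv (g := fun x y => iteratedDeriv p (fun x => g x y) x) ih

/-- Banach–Steinhaus on `ℓ¹(S)`: each `V i` acts on it as a functional, and its values on the unit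
vectors are the `V i s`. -/
theorem exists_bound_of_summable_mul {ι S : Type*} {V : ι → S → ℝ}
    (hV : ∀ i, ∃ M, ∀ s, |V i s| ≤ M)
    (h : ∀ a : S → ℝ, (Summable fun s => |a s|) → ∃ C, ∀ i, |∑' s, a s * V i s| ≤ C) :
    ∃ C, ∀ i s, |V i s| ≤ C := by
  classical
  choose M hM using hV
  have hsum : ∀ a : lp (fun _ : S => ℝ) 1, Summable fun s => |a s| := fun a => by
    simpa using (memℓp_gen_iff (p := 1) (by simp)).1 (lp.memℓp a)
  have hnorm : ∀ a : lp (fun _ : S => ℝ) 1, ‖a‖ = ∑' s, |a s| := fun a => by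
    simpa using lp.norm_eq_tsum_rpow (p := 1) (by simp) a
  have hle : ∀ (a : lp (fun _ : S => ℝ) 1) i s, |a s * V i s| ≤ |a s| * |M i| := fun a i s => by
    rw [abs_mul]
    exact mul_le_mul_of_nonneg_left ((hM i s).trans (le_abs_self _)) (abs_nonneg _)
  have hs : ∀ (a : lp (fun _ : S => ℝ) 1) i, Summable fun s => a s * V i s := fun a i =>
    Summable.of_norm_bounded ((hsum a).mul_right |M i|) (hle a i)
  let T : ι → lp (fun _ : S => ℝ) 1 →L[ℝ] ℝ := fun i => LinearMap.mkContinuous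
    { toFun := fun a => ∑' s, a s * V i s
      map_add' := fun a b => by
        rw [← (hs a i).tsum_add (hs b i)]
        congr 1; ext s
        simp [add_mul]
      map_smul' := fun r a => by
        simp [← tsum_mul_left, mul_assoc] } |M i| fun a => by
    rw [hnorm, mul_comm, ← tsum_mul_right]
    exact tsum_of_norm_bounded (((hsum a).mul_right |M i|).hasSum) (hle a i)
  obtain ⟨C, hC⟩ := banach_steinhaus (g := T) fun a => h a (hsum a)
  refine ⟨C, fun i s => ?_⟩
  have h1 := (T i).le_opNorm (lp.single 1 s (1 : ℝ))
  have h2 : T i (lp.single 1 s (1 : ℝ)) = V i s := by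
    change ∑' s', (lp.single 1 s (1 : ℝ) : lp (fun _ : S => ℝ) 1) s' * V i s' = _
    rw [tsum_eq_single s (fun s' hs' => by simp [lp.single_apply, hs'])]
    simp
  rw [h2, lp.norm_single (by simp)] at h1
  simpa using h1.trans (mul_le_mul_of_nonneg_right (hC i) (norm_nonneg _))

/-- This makes weighted sums of point evaluations with `ℓ¹` weights on a compact interval admissible
as test functionals. After a cutoff in `t` the derivatives are bounded uniformly in `s`, so the
series can be differentiated termwise. -/
theorem contDiff_tsum_mul_of_contDiff {g : ℝ → ℝ → ℝ}
    (hg : ContDiff ℝ ∞ fun q : ℝ × ℝ => g q.1 q.2) {R : ℝ} {a : Set.Icc (-R) R → ℝ}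
    (ha : Summable fun s => |a s|) : ContDiff ℝ ∞ fun t => ∑' s, a s * g t s := by
  refine contDiff_iff_contDiffAt.2 fun t₀ => ?_
  obtain ⟨β, hβ, hβ1, hβ0, hβb⟩ := exists_smooth_cutoff (R := |t₀| + 1) (by positivity)
  have h1 : (fun t => ∑' s, a s * g t s) =ᶠ[nhds t₀] fun t => ∑' s, a s * (β t * g t s) := by
    have : ∀ᶠ t : ℝ in nhds t₀, |t| < |t₀| + 1 :=
      continuous_abs.continuousAt.eventually_lt continuousAt_const (by simp)
    filter_upwards [this] with t ht
    simp [hβ1 t ht.le]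
  refine ContDiffAt.congr_of_eventuallyEq (ContDiff.contDiffAt ?_) h1
  have hsl : ∀ y, ContDiff ℝ ∞ fun x => g x y := fun y =>
    hg.comp (contDiff_id.prodMk contDiff_const)
  have hb := exists_bound_iteratedDeriv_mul hβ hβ0 hβb (g := fun (s : Set.Icc (-R) R) t => g t s)
    (fun s => hsl s) fun p => by
      obtain ⟨C, hC⟩ := ((isCompact_Icc (a := -(|t₀| + 1 + 1)) (b := |t₀| + 1 + 1)).prod
        (isCompact_Icc (a := -R) (b := R))).exists_bound_of_continuousOn
        (contDiff_uncurry_iteratedDeriv hg p).continuous.continuousOn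
      exact ⟨C, fun s x hx => hC (x, s) ⟨abs_le.1 hx, s.2⟩⟩
  choose C hC using hb
  refine contDiff_tsum (N := ⊤) (v := fun k s => |a s| * C k)
    (fun s => contDiff_const.mul (hβ.mul (hsl s))) (fun k _ => ha.mul_right _) fun k s x _ => ?_
  have h2 : iteratedFDeriv ℝ k (fun t => a s * (β t * g t s)) x =
      a s • iteratedFDeriv ℝ k (fun t => β t * g t s) x := by
    change iteratedFDeriv ℝ k (a s • fun t => β t * g t s) x = _
    exact iteratedFDeriv_const_smul_apply
      (((hβ.mul (hsl s)).of_le (by exact_mod_cast le_top)).contDiffAt)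
  rw [h2, norm_smul, norm_eq_abs]
  exact mul_le_mul_of_nonneg_left (hC k s x) (abs_nonneg _)

/-- A curve in `C^∞(ℝ, ℝ)` that is smooth along all test functionals is smooth in both variables. -/
theorem contDiff_of_contDiff_functionals {c : ℝ → ℝ → ℝ} (hc : ∀ t, ContDiff ℝ ∞ (c t))
    (h : ∀ φ : (ℝ → ℝ) → ℝ, (∀ d : ℝ → ℝ → ℝ, (ContDiff ℝ ∞ fun q : ℝ × ℝ => d q.1 q.2) →
      ContDiff ℝ ∞ fun t => φ (d t)) → ContDiff ℝ ∞ fun t => φ (c t)) :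
    ContDiff ℝ ∞ fun q : ℝ × ℝ => c q.1 q.2 := by
  have hsl : ∀ s, ContDiff ℝ ∞ fun t => c t s := fun s =>
    h (fun f => f s) fun d hd => hd.comp (contDiff_id.prodMk contDiff_const)
  have hφ : ∀ (p : ℕ) (R : ℝ) (a : Set.Icc (-R) R → ℝ), (Summable fun s => |a s|) →
      ContDiff ℝ ∞ fun t => ∑' s, a s * iteratedDeriv p (c t) s := fun p R a ha =>
    h (fun f => ∑' s, a s * iteratedDeriv p f s) fun d hd => contDiff_tsum_mul_of_contDiff
      (g := fun t s => iteratedDeriv p (d t) s) ((contDiff_uncurry_iteratedDeriv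
        (g := fun s t => d t s) (hd.comp (contDiff_snd.prodMk contDiff_fst)) p).comp (contDiff_snd.prodMk contDiff_fst)) ha
  have hbc : ∀ (p : ℕ) (R t : ℝ), ∃ M, ∀ s : Set.Icc (-R) R, |iteratedDeriv p (c t) s| ≤ M := by
    intro p R t
    obtain ⟨M, hM⟩ := (isCompact_Icc (a := -R) (b := R)).exists_bound_of_continuousOn
      ((hc t).continuous_iteratedDeriv p (by exact_mod_cast le_top)).continuousOn
    exact ⟨M, fun s => hM s s.2⟩
  refine contDiff_of_locally_bounded_partials hsl hc (fun p R => ?_) fun p R => ?_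
  -- The `t`-derivatives. The uniform bound and the exchange of sum and derivative are proved
  -- together by induction on `p`, since each new bound uses the exchange at the previous order.
  · suffices H : (∀ R' : ℝ, ∃ C, ∀ t, |t| ≤ R' → ∀ s : Set.Icc (-R) R,
        |iteratedDeriv p (fun t => c t s) t| ≤ C) ∧
        ∀ a : Set.Icc (-R) R → ℝ, (Summable fun s => |a s|) → ∀ t,
          ∑' s, a s * iteratedDeriv p (fun t => c t s) t =
            iteratedDeriv p (fun t => ∑' s, a s * c t s) t by
      obtain ⟨C, hC⟩ := H.1 R
      exact ⟨C, fun x y hx hy => hC x hx ⟨y, abs_le.1 hy⟩⟩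
    have hφ0 : ∀ a : Set.Icc (-R) R → ℝ, (Summable fun s => |a s|) →
        ContDiff ℝ ∞ fun t => ∑' s, a s * c t s := fun a ha => by simpa using hφ 0 R a ha
    induction p with
    | zero =>
      refine ⟨fun R' => ?_, fun a _ t => by simp⟩
      obtain ⟨C, hC⟩ := exists_bound_of_summable_mul (ι := Set.Icc (-R') R')
        (V := fun t (s : Set.Icc (-R) R) => c t s) (fun t => by simpa using hbc 0 R t) fun a ha => by
          obtain ⟨C, hC⟩ := (isCompact_Icc (a := -R') (b := R')).exists_bound_of_continuousOn
            (hφ0 a ha).continuous.continuousOn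
          exact ⟨C, fun t => hC t t.2⟩
      exact ⟨C, fun t ht s => by simpa using hC ⟨t, abs_le.1 ht⟩ s⟩
    | succ p ih =>
      obtain ⟨ih1, ih2⟩ := ih
      have hd : ∀ (s t : ℝ), HasDerivAt (iteratedDeriv p fun t => c t s)
          (iteratedDeriv (p + 1) (fun t => c t s) t) t := fun s t => by
        rw [iteratedDeriv_succ]
        exact (((hsl s).differentiable_iteratedDeriv p (by exact_mod_cast WithTop.coe_lt_top _))
          t).hasDerivAt
      have hda : ∀ a : Set.Icc (-R) R → ℝ, (Summable fun s => |a s|) → ∀ t,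
          HasDerivAt (iteratedDeriv p fun t => ∑' s, a s * c t s)
          (iteratedDeriv (p + 1) (fun t => ∑' s, a s * c t s) t) t := fun a ha t => by
        rw [iteratedDeriv_succ]
        exact (((hφ0 a ha).differentiable_iteratedDeriv p
          (by exact_mod_cast WithTop.coe_lt_top _)) t).hasDerivAt
      have hsm : ∀ (a : Set.Icc (-R) R → ℝ), (Summable fun s => |a s|) → ∀ t,
          Summable fun s : Set.Icc (-R) R => a s * iteratedDeriv p (fun t => c t s) t := by
        intro a ha t
        obtain ⟨C, hC⟩ := ih1 |t|
        refine Summable.of_norm_bounded (ha.mul_right C) fun s => ?_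
        rw [norm_eq_abs, abs_mul]
        exact mul_le_mul_of_nonneg_left (hC t le_rfl s) (abs_nonneg _)
      -- Banach–Steinhaus for the difference quotients of the `p`-th derivatives: their weighted
      -- sums are difference quotients of a smooth function, bounded by the mean value inequality.
      -- Letting the increment tend to 0 bounds the next derivative.
      have key : ∀ R' : ℝ, ∃ C, ∀ t, |t| ≤ R' → ∀ s : Set.Icc (-R) R,
          |iteratedDeriv (p + 1) (fun t => c t s) t| ≤ C := by
        intro R'
        obtain ⟨C, hC⟩ := exists_bound_of_summable_mul
          (ι := {q : ℝ × ℝ // |q.1| ≤ R' ∧ |q.2| ≤ 1 ∧ q.2 ≠ 0})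
          (V := fun q (s : Set.Icc (-R) R) => q.1.2⁻¹ * (iteratedDeriv p (fun t => c t s) (q.1.1 + q.1.2) -
            iteratedDeriv p (fun t => c t s) q.1.1)) (fun q => by
              obtain ⟨M, hM⟩ := ih1 (R' + 1)
              refine ⟨|q.1.2⁻¹| * (M + M), fun s => ?_⟩
              rw [abs_mul]
              refine mul_le_mul_of_nonneg_left ((abs_sub _ _).trans (add_le_add
                (hM _ ((abs_add_le _ _).trans (add_le_add q.2.1 q.2.2.1)) s)
                (hM _ (q.2.1.trans (by linarith)) s))) (abs_nonneg _)) fun a ha => by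
              obtain ⟨C, hC⟩ := (isCompact_Icc (a := -(R' + 1))
                (b := R' + 1)).exists_bound_of_continuousOn
                ((hφ0 a ha).continuous_iteratedDeriv (p + 1) (by exact_mod_cast le_top)).continuousOn
              refine ⟨C, fun q => ?_⟩
              have h1 : ∑' s : Set.Icc (-R) R, a s * (q.1.2⁻¹ *
                  (iteratedDeriv p (fun t => c t s) (q.1.1 + q.1.2) -
                  iteratedDeriv p (fun t => c t s) q.1.1)) = q.1.2⁻¹ *
                  (iteratedDeriv p (fun t => ∑' s, a s * c t s) (q.1.1 + q.1.2) -
                  iteratedDeriv p (fun t => ∑' s, a s * c t s) q.1.1) := by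
                rw [← ih2 a ha, ← ih2 a ha, ← (hsm a ha _).tsum_sub (hsm a ha _), ← tsum_mul_left]
                congr 1; ext s; ring
              rw [h1, abs_mul, abs_inv, inv_mul_le_iff₀ (abs_pos.2 q.2.2.2), mul_comm]
              have h2 := Convex.norm_image_sub_le_of_norm_hasDerivWithin_le (C := C)
                (s := Set.Icc (-(R' + 1)) (R' + 1)) (x := q.1.1) (y := q.1.1 + q.1.2)
                (fun t _ => (hda a ha t).hasDerivWithinAt) hC (convex_Icc _ _)
                (abs_le.1 (q.2.1.trans (by linarith)))
                (abs_le.1 ((abs_add_le _ _).trans (add_le_add q.2.1 q.2.2.1)))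
              simpa using h2
        refine ⟨C, fun t ht s => ?_⟩
        have h3 := (hasDerivAt_iff_tendsto_slope_zero.1 (hd s t)).norm
        refine le_of_tendsto h3 ?_
        have h4 : ∀ᶠ r : ℝ in nhdsWithin 0 {0}ᶜ, |r| < 1 := nhdsWithin_le_nhds
          (continuous_abs.continuousAt.eventually_lt continuousAt_const (by simp))
        filter_upwards [h4, self_mem_nhdsWithin] with r hr hr0
        exact hC ⟨(t, r), ht, hr.le, hr0⟩ s
      refine ⟨key, fun a ha t => ?_⟩
      obtain ⟨C, hC⟩ := key (|t| + 1)
      have h5 := hasDerivAt_tsum_of_isPreconnected (y := t) (y₀ := t)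
        (t := Set.Ioo (-(|t| + 1)) (|t| + 1))
        (g := fun (s : Set.Icc (-R) R) t => a s * iteratedDeriv p (fun t => c t s) t)
        (g' := fun (s : Set.Icc (-R) R) t => a s * iteratedDeriv (p + 1) (fun t => c t s) t)
        (ha.mul_right C) isOpen_Ioo isPreconnected_Ioo (fun s t _ => (hd s t).const_mul (a s))
        (fun s t ht => by
          rw [norm_eq_abs, abs_mul]
          exact mul_le_mul_of_nonneg_left (hC t (abs_lt.2 ht).le s) (abs_nonneg _))
        (abs_lt.1 (by linarith)) (hsm a ha t) (abs_lt.1 (by linarith))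
      have h6 : (fun t => ∑' s : Set.Icc (-R) R, a s * iteratedDeriv p (fun t => c t s) t) =
          iteratedDeriv p (fun t => ∑' s, a s * c t s) := funext (ih2 a ha)
      rw [h6] at h5
      exact h5.unique (hda a ha t)
  -- The `s`-derivatives need no induction: their weighted sums are themselves test functionals,
  -- hence smooth in `t`.
  · obtain ⟨C, hC⟩ := exists_bound_of_summable_mul (ι := Set.Icc (-R) R)
      (V := fun t (s : Set.Icc (-R) R) => iteratedDeriv p (c t) s) (fun t => hbc p R t)
      fun a ha => by
        obtain ⟨C, hC⟩ := (isCompact_Icc (a := -R) (b := R)).exists_bound_of_continuousOn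
          (hφ p R a ha).continuous.continuousOn
        exact ⟨C, fun t => hC t t.2⟩
    exact ⟨C, fun x y hx hy => hC ⟨x, abs_le.1 hx⟩ ⟨y, abs_le.1 hy⟩⟩

/-- Differentiation under the integral sign. -/
theorem contDiff_integral_of_contDiff {H : ℝ → ℝ → ℝ}
    (hH : ContDiff ℝ ∞ fun q : ℝ × ℝ => H q.1 q.2) :
    ContDiff ℝ ∞ fun s => ∫ x in (0 : ℝ)..1, H s x := by
  have hd : ∀ {H : ℝ → ℝ → ℝ}, (ContDiff ℝ ∞ fun q : ℝ × ℝ => H q.1 q.2) → ∀ s,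
      HasDerivAt (fun s => ∫ x in (0 : ℝ)..1, H s x)
        (∫ x in (0 : ℝ)..1, deriv (fun s => H s x) s) s := by
    intro H hH s
    have hH' := contDiff_uncurry_deriv hH
    have hcont : ∀ s, Continuous (H s) := fun s =>
      hH.continuous.comp (continuous_const.prodMk continuous_id)
    have hcont' : ∀ s, Continuous fun x => deriv (fun s => H s x) s := fun s =>
      hH'.continuous.comp (continuous_const.prodMk continuous_id)
    obtain ⟨C, hC⟩ := ((isCompact_Icc (a := s - 1) (b := s + 1)).prod
      (isCompact_Icc (a := (0 : ℝ)) (b := 1))).exists_bound_of_continuousOn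
      hH'.continuous.continuousOn
    refine (intervalIntegral.hasDerivAt_integral_of_dominated_loc_of_deriv_le
      (Icc_mem_nhds (show s - 1 < s by linarith) (show s < s + 1 by linarith))
      (bound := fun _ => C) (F' := fun s x => deriv (fun s => H s x) s)
      (Filter.Eventually.of_forall fun s => (hcont s).aestronglyMeasurable)
      ((hcont s).intervalIntegrable _ _) (hcont' s).aestronglyMeasurable
      (Filter.Eventually.of_forall fun x hx r hr => ?_) intervalIntegrable_const
      (Filter.Eventually.of_forall fun x _ r _ => ?_)).2
    · rw [Set.uIoc_of_le zero_le_one] at hx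
      exact hC (r, x) ⟨hr, hx.1.le, hx.2⟩
    · exact (((hH.comp (contDiff_id.prodMk contDiff_const)).differentiable
        (f := fun s => H s x) (by simp)) r).hasDerivAt
  refine contDiff_infty.2 fun n => ?_
  induction n generalizing H with
  | zero => exact contDiff_zero.2 (continuous_iff_continuousAt.2 fun s => (hd hH s).continuousAt)
  | succ n ih =>
    refine (contDiff_succ_iff_deriv (n := n)).2 ⟨fun s => (hd hH s).differentiableAt, by simp, ?_⟩
    have : deriv (fun s => ∫ x in (0 : ℝ)..1, H s x) =
      fun s => ∫ x in (0 : ℝ)..1, deriv (fun s => H s x) s := funext fun s => (hd hH s).deriv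
    rw [this]
    exact ih (contDiff_uncurry_deriv hH)

end RealAnalysis

/-! ### Cartesian closedness and Hadamard's lemma with parameters -/

namespace Frolicher

section CartesianClosed

variable {X : Type u} {Y : Type v} {Z : Type w} [Frolicher X] [Frolicher Y] [Frolicher Z]

theorem comp_mem_curves {c : ℝ → X} (hc : c ∈ curves (X := X)) {d : ℝ → ℝ} (hd : ContDiff ℝ ∞ d) :
    c ∘ d ∈ curves (X := X) :=
  (mem_curves_iff _).2 fun f hf => ((mem_curves_iff c).1 hc f hf).comp hd

theorem isSmooth_of_mem_curves {c : ℝ → X} (hc : c ∈ curves (X := X)) : IsSmooth c :=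
  fun _ hd => comp_mem_curves hc hd

theorem isSmooth_of_functions {f : X → Y}
    (h : ∀ χ : SmoothMap Y ℝ, IsSmooth fun x => χ (f x)) : IsSmooth f := fun c hc =>
  (mem_curves_iff _).2 fun χ hχ =>
    h ⟨χ, fun d hd => (mem_functions_iff χ).1 hχ d hd⟩ c hc

theorem IsSmooth.add {f g : X → ℝ} (hf : IsSmooth f) (hg : IsSmooth g) :
    IsSmooth fun x => f x + g x := fun c hc =>
  ContDiff.add (show ContDiff ℝ ∞ (f ∘ c) from hf c hc) (show ContDiff ℝ ∞ (g ∘ c) from hg c hc)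

theorem IsSmooth.mul {f g : X → ℝ} (hf : IsSmooth f) (hg : IsSmooth g) :
    IsSmooth fun x => f x * g x := fun c hc =>
  ContDiff.mul (show ContDiff ℝ ∞ (f ∘ c) from hf c hc) (show ContDiff ℝ ∞ (g ∘ c) from hg c hc)

theorem isSmooth_sum {ι : Type*} (s : Finset ι) {f : ι → X → ℝ} (hf : ∀ i ∈ s, IsSmooth (f i)) :
    IsSmooth fun x => ∑ i ∈ s, f i x := fun c hc =>
  show ContDiff ℝ ∞ fun t => ∑ i ∈ s, f i (c t) from
    ContDiff.sum fun i hi => show ContDiff ℝ ∞ (f i ∘ c) from hf i hi c hc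

theorem contDiff_of_isSmooth_prod {f : ℝ → ℝ → ℝ} (hf : IsSmooth fun q : ℝ × ℝ => f q.1 q.2) :
    ContDiff ℝ ∞ fun q : ℝ × ℝ => f q.1 q.2 :=
  contDiff_of_contDiff_along_curves fun c d hc hd => hf (fun t => (c t, d t)) ⟨hc, hd⟩

/-- Evaluation is smooth, i.e. Frölicher spaces are cartesian closed. -/
theorem isSmooth_evaluation : IsSmooth fun p : SmoothMap Y X × Y => p.1 p.2 := by
  intro γ hγ
  refine (mem_curves_iff _).2 fun f hf => ?_
  have hf' : IsSmooth f := fun c hc => (mem_functions_iff f).1 hf c hc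
  have hy : IsSmooth fun t => (γ t).2 := isSmooth_of_mem_curves hγ.2
  -- The time parameters of the map and of its argument are separated. Joint smoothness in `(t, s)`
  -- is proved, and the claim is its restriction to the diagonal.
  have key := contDiff_of_contDiff_functionals (c := fun t s => f ((γ t).1 (γ s).2))
    (fun t => hf'.comp ((γ t).1.smooth.comp hy) _root_.id
      (show ContDiff ℝ ∞ (_root_.id : ℝ → ℝ) from contDiff_id)) fun φ hφ => ?_
  · exact key.comp (contDiff_id.prodMk contDiff_id)
  -- A test functional on `C^∞(ℝ, ℝ)` pulls back along `h ↦ f ∘ h ∘ y` to a function on `X^Y`, which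
  -- a curve of maps must carry to a smooth function.
  · refine hγ.1 (fun h => φ fun s => f (h (γ s).2)) fun d hd => ?_
    refine hφ (fun t s => f (d t (γ s).2)) (contDiff_of_isSmooth_prod
      (f := fun t s => f (d t (γ s).2)) ?_)
    exact hf'.comp (hd.comp (isSmooth_fst.prodMk (hy.comp isSmooth_snd)))

theorem IsSmooth.apply {f : Z → SmoothMap Y X} {g : Z → Y} (hf : IsSmooth f) (hg : IsSmooth g) :
    IsSmooth fun z => f z (g z) :=
  isSmooth_evaluation.comp (hf.prodMk hg)

theorem isSmooth_of_uncurry {f : Z → SmoothMap Y X} (hf : IsSmooth fun p : Z × Y => f p.1 p.2) :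
    IsSmooth f :=
  (SmoothMap.curry ⟨_, hf⟩).smooth

end CartesianClosed

section Hadamard

variable {A : Type u} [Frolicher A]

/-- The quotient is `∫₀¹ ∂ₜχ(a, tx) dx`. Its smoothness is tested along curves, where Boman's
theorem makes the integrand jointly smooth. -/
theorem exists_hadamard_real (χ : SmoothMap (A × ℝ) ℝ) :
    ∃ q : SmoothMap (A × ℝ) ℝ, ∀ a t, χ (a, t) = χ (a, 0) + t * q (a, t) := by
  refine ⟨⟨fun p => ∫ x in (0 : ℝ)..1, deriv (fun t => χ (p.1, t)) (p.2 * x), ?_⟩, fun a t => ?_⟩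
  · intro c hc
    have h1 : ContDiff ℝ ∞ fun q : ℝ × ℝ => χ ((c q.2).1, q.1) :=
      contDiff_of_isSmooth_prod (f := fun x s => χ ((c s).1, x)) (χ.smooth.comp
        (((isSmooth_of_mem_curves hc.1).comp isSmooth_snd).prodMk isSmooth_fst))
    have h2 := contDiff_uncurry_deriv (g := fun x s => χ ((c s).1, x)) h1
    have h3 : ContDiff ℝ ∞ fun s => (c s).2 := hc.2
    exact contDiff_integral_of_contDiff
      (H := fun s x => deriv (fun t => χ ((c s).1, t)) ((c s).2 * x))
      (h2.comp (((h3.comp contDiff_fst).mul contDiff_snd).prodMk contDiff_fst))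
  · have h1 : ContDiff ℝ ∞ fun t => χ (a, t) :=
      χ.smooth (fun t => (a, t)) ⟨const_mem_curves a, show ContDiff ℝ ∞ fun t : ℝ => t from contDiff_id⟩
    change χ (a, t) = χ (a, 0) + t * ∫ x in (0 : ℝ)..1, deriv (fun t => χ (a, t)) (t * x)
    rw [intervalIntegral.mul_integral_comp_mul_left, mul_zero, mul_one,
      intervalIntegral.integral_deriv_eq_sub' _ rfl
        (fun x _ => (h1.differentiable (by simp)) x)
        (h1.continuous_deriv (by simp)).continuousOn]
    ring

/-- Telescoping: the coordinates of `x` are switched on one at a time, and each increment is an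
instance of the one-variable case. -/
theorem exists_hadamard {k : ℕ} (χ : SmoothMap (A × (Fin k → ℝ)) ℝ) :
    ∃ q : Fin k → SmoothMap (A × (Fin k → ℝ)) ℝ,
      ∀ a x, χ (a, x) = χ (a, 0) + ∑ i, x i * q i (a, x) := by
  have hins : ∀ i : Fin k, IsSmooth fun p : (A × (Fin k → ℝ)) × ℝ => fun j : Fin k =>
      if j < i then p.1.2 j else if j = i then p.2 else 0 := fun i => isSmooth_pi fun j => by
    split_ifs
    · exact (isSmooth_eval j).comp (isSmooth_snd.comp isSmooth_fst)
    · exact isSmooth_snd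
    · exact isSmooth_const 0
  choose q hq using fun i => exists_hadamard_real (A := A × (Fin k → ℝ))
    ⟨_, χ.smooth.comp ((isSmooth_fst.comp isSmooth_fst).prodMk (hins i))⟩
  refine ⟨fun i => ⟨fun p => q i (p, p.2 i), (q i).smooth.comp
    (isSmooth_id.prodMk ((isSmooth_eval i).comp isSmooth_snd))⟩, fun a x => ?_⟩
  set F : ℕ → ℝ := fun n => χ (a, fun j : Fin k => if (j : ℕ) < n then x j else 0) with hF
  have h0 : F 0 = χ (a, 0) := by
    simp only [hF, Nat.not_lt_zero, if_false]; rfl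
  have hk : F k = χ (a, x) := by
    simp only [hF, Fin.is_lt, if_true]
  have hstep : ∀ i : Fin k, F (i + 1) - F i = x i * q i ((a, x), x i) := by
    intro i
    have := hq i (a, x) (x i)
    simp only [Function.comp_apply] at this
    have e1 : F (i + 1) = χ (a, fun j => if j < i then x j else if j = i then x i else 0) := by
      simp only [hF]
      congr 3
      ext j
      rcases lt_trichotomy j i with h | h | h
      · simp [h, Nat.lt_succ_of_lt (Fin.lt_def.1 h)]
      · simp [h]
      · have h' : ¬ (j : ℕ) < i + 1 := by have := Fin.lt_def.1 h; omega
        simp [h', h.not_gt, h.ne']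
    have e2 : F i = χ (a, fun j => if j < i then x j else if j = i then 0 else 0) := by
      simp only [hF, Fin.lt_def, ite_self]
    rw [e1, e2, this]
    ring
  calc χ (a, x) = χ (a, 0) + (F k - F 0) := by rw [hk, h0]; ring
    _ = χ (a, 0) + ∑ i : Fin k, (F (i + 1) - F i) := by
        rw [Fin.sum_univ_eq_sum_range (fun n => F (n + 1) - F n), Finset.sum_range_sub]
    _ = _ := by simp only [hstep]

end Hadamard

end Frolicher

/-! ### Weil ideals and smooth families -/

namespace Cinf

variable {A : Type u} [Frolicher A] {k : ℕ}

/-- The function `x ↦ χ (f x, x)`. -/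
def graphComp (χ : SmoothMap (A × (Fin k → ℝ)) ℝ) (f : SmoothMap (Fin k → ℝ) A) : Cinf k :=
  ⟨fun x => χ (f x, x), χ.smooth.comp (f.smooth.prodMk isSmooth_id)⟩

/-- The function `x ↦ χ (a, x)`. -/
def slice (χ : SmoothMap (A × (Fin k → ℝ)) ℝ) (a : A) : Cinf k :=
  ⟨fun x => χ (a, x), χ.smooth.comp ((isSmooth_const a).prodMk isSmooth_id)⟩

theorem coord_mem_maxIdeal (i : Fin k) : coord i ∈ maxIdeal k := rfl

theorem mem_maxIdeal {f : Cinf k} : f ∈ maxIdeal k ↔ f.1 0 = 0 := Iff.rfl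

theorem coe_sum {ι : Type*} (s : Finset ι) (f : ι → Cinf k) (x : Fin k → ℝ) :
    (∑ i ∈ s, f i).1 x = ∑ i ∈ s, (f i).1 x := by
  induction s using Finset.cons_induction with
  | empty => simp
  | cons a s ha ih => rw [Finset.sum_cons, Finset.sum_cons, ← ih]; rfl

/-- By Hadamard, `χ(a, x) = χ(a, 0) + ∑ xᵢ qᵢ(a, x)`. The first term contributes an element of `I`
by the definition of the relation, and the factors `xᵢ` raise the power of the maximal ideal by one.
A large power is absorbed by a Weil ideal. -/
theorem graphComp_sub_mem_sup {I : Ideal (Cinf k)} {f g : SmoothMap (Fin k → ℝ) A}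
    (h : (modSetoid A I).r f g) (r : ℕ) (χ : SmoothMap (A × (Fin k → ℝ)) ℝ) :
    graphComp χ f - graphComp χ g ∈ I ⊔ maxIdeal k ^ r := by
  induction r generalizing χ with
  | zero => simp
  | succ r ih =>
    obtain ⟨q, hq⟩ := exists_hadamard χ
    let χ₀ : SmoothMap A ℝ := ⟨fun a => χ (a, 0), χ.smooth.comp (isSmooth_id.prodMk (isSmooth_const 0))⟩
    have h1 : graphComp χ f - graphComp χ g = (ofFunction χ₀ f - ofFunction χ₀ g) +
        ∑ i, coord i * (graphComp (q i) f - graphComp (q i) g) := by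
      ext x
      have h2 : (∑ i, coord i * (graphComp (q i) f - graphComp (q i) g)).1 x =
          ∑ i, x i * (q i (f x, x) - q i (g x, x)) := coe_sum _ _ _
      change χ (f x, x) - χ (g x, x) = (χ (f x, 0) - χ (g x, 0)) +
        (∑ i, coord i * (graphComp (q i) f - graphComp (q i) g)).1 x
      rw [h2, hq, hq (g x)]
      simp only [mul_sub, Finset.sum_sub_distrib]
      ring
    rw [h1]
    refine add_mem (Ideal.mem_sup_left (h.2 χ₀)) (sum_mem fun i _ => ?_)
    have h3 := Ideal.mul_mem_mul (coord_mem_maxIdeal i) (ih (q i))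
    rw [Ideal.mul_sup, ← pow_succ'] at h3
    have h4 : maxIdeal k * I ⊔ maxIdeal k ^ (r + 1) ≤ I ⊔ maxIdeal k ^ (r + 1) :=
      sup_le_sup_right Ideal.mul_le_right _
    exact h4 h3

theorem graphComp_sub_mem (W : WeilAlgebra) {f g : SmoothMap (Fin W.gens → ℝ) A}
    (h : (modSetoid A W.ideal).r f g) (χ : SmoothMap (A × (Fin W.gens → ℝ)) ℝ) :
    graphComp χ f - graphComp χ g ∈ W.ideal := by
  obtain ⟨r, hr⟩ := W.exists_pow_le
  have := graphComp_sub_mem_sup h r χ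
  rwa [sup_eq_left.2 hr] at this

/-- Hadamard's expansion again: `l ∘ (xᵢ ·)` kills one power of the maximal ideal less than needed
for `l`, and the remaining term is `χ(a, 0) l(1)`. -/
theorem isSmooth_linear_slice_aux (r : ℕ) (l : Cinf k →ₗ[ℝ] ℝ) (hl : ∀ f ∈ maxIdeal k ^ r, l f = 0)
    (χ : SmoothMap (A × (Fin k → ℝ)) ℝ) : IsSmooth fun a => l (slice χ a) := by
  induction r generalizing l χ with
  | zero =>
    have : (fun a => l (slice χ a)) = fun _ => 0 := funext fun a => hl _ (by simp)
    rw [this]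
    exact isSmooth_const 0
  | succ r ih =>
    obtain ⟨q, hq⟩ := exists_hadamard χ
    have h1 : (fun a => l (slice χ a)) = fun a => χ (a, 0) * l 1 +
        ∑ i, (l ∘ₗ LinearMap.mulLeft ℝ (coord i)) (slice (q i) a) := by
      funext a
      have h2 : slice χ a = χ (a, 0) • (1 : Cinf k) + ∑ i, coord i * slice (q i) a := by
        ext x
        have h3 : (∑ i, coord i * slice (q i) a).1 x = ∑ i, x i * q i (a, x) := coe_sum _ _ _
        change χ (a, x) = χ (a, 0) * 1 + (∑ i, coord i * slice (q i) a).1 x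
        rw [h3, hq, mul_one]
      rw [h2]
      simp
    rw [h1]
    refine (IsSmooth.mul (χ.smooth.comp (isSmooth_id.prodMk (isSmooth_const 0)))
      (isSmooth_const _)).add (isSmooth_sum _ fun i _ => ih _ (fun f hf => ?_) (q i))
    refine hl _ ?_
    rw [pow_succ']
    exact Ideal.mul_mem_mul (coord_mem_maxIdeal i) hf

theorem isSmooth_linear_slice (W : WeilAlgebra) (l : (Cinf W.gens ⧸ W.ideal) →ₗ[ℝ] ℝ)
    (χ : SmoothMap (A × (Fin W.gens → ℝ)) ℝ) :
    IsSmooth fun a => l (Ideal.Quotient.mk W.ideal (slice χ a)) := by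
  obtain ⟨r, hr⟩ := W.exists_pow_le
  refine isSmooth_linear_slice_aux r (l ∘ₗ (Ideal.Quotient.mkₐ ℝ W.ideal).toLinearMap)
    (fun f hf => ?_) χ
  have : (Ideal.Quotient.mk W.ideal f) = 0 := Ideal.Quotient.eq_zero_iff_mem.2 (hr hf)
  simp [this]

theorem maxIdeal_le_tensorIdeal (m n : ℕ) :
    maxIdeal (m + n) ≤ tensorIdeal (maxIdeal m) (maxIdeal n) := by
  intro f hf
  -- The parameter space `ℝ` is a dummy; the point is that the coordinates generate the maximal
  -- ideal.
  obtain ⟨q, hq⟩ := exists_hadamard (A := ℝ) (k := m + n) ⟨fun p => f.1 p.2,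
    IsSmooth.comp f.2 isSmooth_snd⟩
  have h1 : f = ∑ i, coord i * slice (q i) 0 := by
    ext x
    rw [show ((∑ i, coord i * slice (q i) 0 : Cinf (m + n)) : (Fin (m + n) → ℝ) → ℝ) x =
      ∑ i, x i * q i (0, x) from coe_sum _ _ _]
    have := hq 0 x
    simp only at this
    rw [mem_maxIdeal.1 hf, zero_add] at this
    exact this
  rw [h1]
  refine sum_mem fun i _ => Ideal.mul_mem_right _ _ ?_
  refine Fin.addCases (fun j => ?_) (fun j => ?_) i
  · exact Ideal.mem_sup_left (Ideal.mem_map_of_mem (inl m n) (coord_mem_maxIdeal j))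
  · exact Ideal.mem_sup_right (Ideal.mem_map_of_mem (inr m n) (coord_mem_maxIdeal j))

end Cinf

/-- The tensor product of Weil algebras. -/
def WeilAlgebra.tensor (W₁ W₂ : WeilAlgebra) : WeilAlgebra where
  gens := W₁.gens + W₂.gens
  ideal := Cinf.tensorIdeal W₁.ideal W₂.ideal
  le_maxIdeal := sup_le
    (Ideal.map_le_iff_le_comap.2 fun _ hf => W₁.le_maxIdeal hf)
    (Ideal.map_le_iff_le_comap.2 fun _ hf => W₂.le_maxIdeal hf)
  exists_pow_le := by
    obtain ⟨r₁, h₁⟩ := W₁.exists_pow_le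
    obtain ⟨r₂, h₂⟩ := W₂.exists_pow_le
    -- In a product of `r₁ + r₂` factors from two ideals, at least `r₁` come from the first or at
    -- least `r₂` from the second.
    refine ⟨r₁ + r₂, (Ideal.pow_right_mono (Cinf.maxIdeal_le_tensorIdeal _ _) _).trans
      (Ideal.sup_pow_add_le_pow_sup_pow.trans ?_)⟩
    rw [← Ideal.map_pow, ← Ideal.map_pow]
    exact sup_le_sup (Ideal.map_mono h₁) (Ideal.map_mono h₂)

/-- The algebra `ℝ = C^∞(ℝ⁰)`. -/
def WeilAlgebra.trivial : WeilAlgebra where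
  gens := 0
  ideal := ⊥
  le_maxIdeal := bot_le
  exists_pow_le := ⟨1, fun f hf => by
    rw [pow_one] at hf
    refine Ideal.mem_bot.2 (Subtype.ext (funext fun x => ?_))
    rw [Subsingleton.elim x 0]
    exact hf⟩

/-! ### Isomorphisms of Frölicher spaces and of prolongations -/

/-- Isomorphisms of Frölicher spaces. -/
structure SmoothEquiv (X : Type u) (Y : Type v) [Frolicher X] [Frolicher Y] where
  hom : SmoothMap X Y
  inv : SmoothMap Y X
  left_inv : ∀ x, inv (hom x) = x
  right_inv : ∀ y, hom (inv y) = y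

namespace SmoothMap

variable {X : Type u} {Y : Type v} {Z : Type w} [Frolicher X] [Frolicher Y] [Frolicher Z]

/-- Evaluation at a point. -/
def evalAt (X : Type u) [Frolicher X] (y : Y) : SmoothMap (SmoothMap Y X) X :=
  ⟨fun f => f y, isSmooth_id.apply (isSmooth_const y)⟩

/-- The transpose of a smooth map `Z → X^Y`. -/
def uncurry (f : SmoothMap Z (SmoothMap Y X)) : SmoothMap (Z × Y) X :=
  ⟨fun p => f p.1 p.2, (f.smooth.comp isSmooth_fst).apply isSmooth_snd⟩

end SmoothMap

namespace SmoothEquiv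

variable {X : Type u} {Y : Type v} {Z : Type w} [Frolicher X] [Frolicher Y] [Frolicher Z]

def symm (e : SmoothEquiv X Y) : SmoothEquiv Y X := ⟨e.inv, e.hom, e.right_inv, e.left_inv⟩

def trans (e : SmoothEquiv X Y) (e' : SmoothEquiv Y Z) : SmoothEquiv X Z where
  hom := e'.hom.comp e.hom
  inv := e.inv.comp e'.inv
  left_inv x := by
    change e.inv (e'.inv (e'.hom (e.hom x))) = x
    rw [e'.left_inv, e.left_inv]
  right_inv z := by
    change e'.hom (e.hom (e.inv (e'.inv z))) = z
    rw [e.right_inv, e'.right_inv]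

theorem injective (e : SmoothEquiv X Y) : Function.Injective e.hom.toFun :=
  Function.LeftInverse.injective e.left_inv

/-- The isomorphism `X^Z ≅ Y^Z` induced by an isomorphism `X ≅ Y`. -/
def postcomp (Z : Type w) [Frolicher Z] (e : SmoothEquiv X Y) :
    SmoothEquiv (SmoothMap Z X) (SmoothMap Z Y) where
  hom := SmoothMap.postcomp Z e.hom
  inv := SmoothMap.postcomp Z e.inv
  left_inv f := SmoothMap.ext (funext fun z => e.left_inv (f z))
  right_inv f := SmoothMap.ext (funext fun z => e.right_inv (f z))

/-- The exponential law `(X^Y)^Z ≅ X^{Z × Y}`. -/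
def curry (X : Type u) (Y : Type v) (Z : Type w) [Frolicher X] [Frolicher Y] [Frolicher Z] :
    SmoothEquiv (SmoothMap Z (SmoothMap Y X)) (SmoothMap (Z × Y) X) where
  hom := ⟨SmoothMap.uncurry, isSmooth_of_uncurry
    ((isSmooth_fst.apply (isSmooth_fst.comp isSmooth_snd)).apply (isSmooth_snd.comp isSmooth_snd))⟩
  inv := ⟨SmoothMap.curry, isSmooth_of_uncurry (isSmooth_of_uncurry
    ((isSmooth_fst.comp isSmooth_fst).apply ((isSmooth_snd.comp isSmooth_fst).prodMk isSmooth_snd)))⟩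
  left_inv _ := rfl
  right_inv _ := rfl

end SmoothEquiv

namespace Prolong

variable {X : Type u} {Y : Type v} [Frolicher X] [Frolicher Y]

/-- The structure of `X ⊗ W` is initial for linear forms on `W`, so this reduces to the smoothness
of `l` applied to slices. -/
theorem isSmooth_mk (W : WeilAlgebra) {f : Y → SmoothMap (Fin W.gens → ℝ) X} (hf : IsSmooth f) :
    IsSmooth fun y => mk W.ideal (f y) := by
  rintro c hc _ ⟨χ, l, rfl⟩
  exact Cinf.isSmooth_linear_slice W l
    ⟨_, χ.smooth.comp ((hf.comp isSmooth_fst).apply isSmooth_snd)⟩ c hc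

/-- The isomorphism `X ⊗ W ≅ Y ⊗ W` induced by an isomorphism `X ≅ Y`. -/
def mapEquiv {k : ℕ} (I : Ideal (Cinf k)) (e : SmoothEquiv X Y) :
    SmoothEquiv (Prolong X I) (Prolong Y I) where
  hom := map I e.hom
  inv := map I e.inv
  left_inv q := by
    induction q using Quotient.ind with | _ f
    exact congrArg (mk I) (SmoothMap.ext (funext fun x => e.left_inv (f x)))
  right_inv q := by
    induction q using Quotient.ind with | _ f
    exact congrArg (mk I) (SmoothMap.ext (funext fun x => e.right_inv (f x)))

/-- The smooth map `X ⊗ C^∞(ℝᵏ)/I → X ⊗ C^∞(ℝˡ)/J` given by substitution of a smooth map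
`ℝˡ → ℝᵏ`. -/
def reindex (X : Type u) [Frolicher X] {k l : ℕ} {I : Ideal (Cinf k)} {J : Ideal (Cinf l)}
    (p : SmoothMap (Fin l → ℝ) (Fin k → ℝ)) (h0 : p 0 = 0) (hp : I ≤ J.comap (Cinf.pullback p)) :
    SmoothMap (Prolong X I) (Prolong X J) where
  toFun := Quotient.map (fun f => f.comp p) fun f g h =>
    ⟨by
      change f (p 0) = g (p 0)
      rw [h0]
      exact h.1, fun χ => hp (h.2 χ)⟩
  smooth := by
    rintro c hc _ ⟨χ, l, rfl⟩
    let P : Cinf k →ₐ[ℝ] Cinf _ := { Cinf.pullback p with commutes' := fun _ => rfl }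
    have h := hc _ ⟨χ, l ∘ₗ (Ideal.quotientMapₐ J P hp).toLinearMap, rfl⟩
    convert h using 1
    funext t
    change l (toQuotient χ (Quotient.map _ _ (c t))) = l (Ideal.quotientMapₐ J P hp (toQuotient χ (c t)))
    induction c t using Quotient.ind
    rfl

/-- The isomorphism `X ≅ X ⊗ ℝ`. -/
def trivialEquiv (X : Type u) [Frolicher X] :
    SmoothEquiv X (Prolong X WeilAlgebra.trivial.ideal) where
  hom := ⟨fun x => mk _ ⟨fun _ => x, isSmooth_const x⟩,
    isSmooth_mk WeilAlgebra.trivial (isSmooth_of_uncurry isSmooth_fst)⟩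
  inv := ⟨Quotient.lift (fun f => f 0) fun _ _ h => h.1, isSmooth_of_functions fun χ c hc => by
    let E : Cinf 0 →ₐ[ℝ] ℝ := (Pi.evalAlgHom ℝ (fun _ : Fin 0 → ℝ => ℝ) 0).comp (Cinf 0).val
    let L := Ideal.Quotient.liftₐ WeilAlgebra.trivial.ideal E
      (fun f hf => WeilAlgebra.trivial.le_maxIdeal hf)
    have h : ContDiff ℝ ∞ _ := hc _ ⟨χ, L.toLinearMap, rfl⟩
    change ContDiff ℝ ∞ _
    refine (congrArg (ContDiff ℝ ∞) (funext fun t => ?_)).mpr h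
    change χ (Quotient.lift _ _ (c t)) = L (toQuotient χ (c t))
    induction c t using Quotient.ind
    rfl⟩
  left_inv _ := rfl
  right_inv q := by
    induction q using Quotient.ind with | _ f
    refine congrArg (mk _) (SmoothMap.ext (funext fun x => ?_))
    exact congrArg f.toFun (funext fun i => i.elim0)

/-- The isomorphism `X ⊗ (ℝ ⊗_∞ W) ≅ X ⊗ W`. -/
def trivialTensorEquiv (X : Type u) [Frolicher X] (W : WeilAlgebra) :
    SmoothEquiv (Prolong X (Cinf.tensorIdeal WeilAlgebra.trivial.ideal W.ideal))
      (Prolong X W.ideal) where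
  hom := reindex X ⟨fun x => Fin.append 0 x, isSmooth_append (isSmooth_const 0) isSmooth_id⟩
    (funext fun i => Fin.addCases (fun j => j.elim0) (fun j => by simp) i)
    (sup_le (by
      rw [WeilAlgebra.trivial, Ideal.map_bot]; exact bot_le)
      (Ideal.map_le_iff_le_comap.2 fun f hf => by
        rw [Ideal.mem_comap, Ideal.mem_comap]
        convert hf
        ext x
        exact congrArg f.1 (funext fun i => Fin.append_right (m := 0) 0 x i)))
  inv := reindex X ⟨fun x i => x (Fin.natAdd 0 i), isSmooth_pi fun _ => isSmooth_eval _⟩ rfl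
    fun f hf => Ideal.mem_sup_right (Ideal.mem_map_of_mem (Cinf.inr _ _) hf)
  left_inv q := by
    induction q using Quotient.ind with | _ f
    refine congrArg (mk _) (SmoothMap.ext (funext fun x => congrArg f.toFun (funext fun i => ?_)))
    refine Fin.addCases (fun j => j.elim0) (fun j => ?_) i
    exact Fin.append_right (m := 0) 0 (fun i => x (Fin.natAdd 0 i)) j
  right_inv q := by
    induction q using Quotient.ind with | _ f
    refine congrArg (mk _) (SmoothMap.ext (funext fun x => congrArg f.toFun (funext fun i => ?_)))
    exact Fin.append_right (m := 0) 0 x i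

end Prolong

/-! ### Weil exponentiability of exponentials -/

/-- For a Weil-exponentiable space, `X^Y ⊗ W ≅ (X ⊗ W)^Y`. -/
theorem WeilExponentiable.exists_smoothEquiv {X : FS.{u}} (hX : WeilExponentiable X) (Y : FS.{u})
    (W : WeilAlgebra) : ∃ e : SmoothEquiv (Prolong (SmoothMap Y X) W.ideal)
      (SmoothMap Y (Prolong X W.ideal)),
      ∀ q y, e.hom q y = Prolong.map W.ideal (SmoothMap.evalAt X y) q := by
  -- The isomorphism is `X^Y ⊗ W ≅ (X ⊗ ℝ)^Y ⊗ W ≅ (X ⊗ (ℝ ⊗_∞ W))^Y ≅ (X ⊗ W)^Y`.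
  obtain ⟨Φ, Ψ, hl, hr, hΦ⟩ := hX Y WeilAlgebra.trivial W
  refine ⟨((Prolong.mapEquiv W.ideal ((Prolong.trivialEquiv X).postcomp Y)).trans
    ⟨Φ, Ψ, hl, hr⟩).trans ((Prolong.trivialTensorEquiv X W).postcomp Y), fun q y => ?_⟩
  induction q using Quotient.ind with | _ h
  let p : SmoothMap (Fin (0 + W.gens) → ℝ) (Fin W.gens → ℝ) :=
    ⟨fun x i => x (Fin.natAdd 0 i), isSmooth_pi fun _ => isSmooth_eval _⟩
  have h1 := hΦ ⟨fun q => h (p q.1) q.2, ((h.smooth.comp p.smooth).comp isSmooth_fst).apply isSmooth_snd⟩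
    ((SmoothMap.postcomp Y (Prolong.trivialEquiv X).hom).comp h) (fun b y => ?_) y
  · refine (congrArg (Prolong.trivialTensorEquiv X W).hom.toFun h1).trans ?_
    refine congrArg (Prolong.mk _) (SmoothMap.ext (funext fun x => ?_))
    change h _ y = h x y
    congr 2
    exact funext fun i => Fin.append_right (m := 0) 0 x i
  · refine congrArg (Prolong.mk _) (SmoothMap.ext (funext fun a => ?_))
    change h b y = h _ y
    congr 2
    exact funext fun i => (Fin.append_right (m := 0) a b i).symm

/-- Exponentials of Weil-exponentiable spaces are Weil-exponentiable. -/
theorem WeilExponentiable.exp {X : FS.{u}} (hX : WeilExponentiable X) (Y : FS.{u}) :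
    WeilExponentiable (FS.exp X Y) := by
  intro Z W₁ W₂
  obtain ⟨e₁, he₁⟩ := hX.exists_smoothEquiv Y W₁
  obtain ⟨e, he⟩ := hX.exists_smoothEquiv Y (W₁.tensor W₂)
  obtain ⟨Φ, Ψ, hl, hr, hΦ⟩ := hX ⟨Z × Y⟩ W₁ W₂
  -- The chain runs from `(X^Y ⊗ W₁)^Z ⊗ W₂` through `((X ⊗ W₁)^Y)^Z ⊗ W₂`, `(X ⊗ W₁)^{Z × Y} ⊗ W₂`,
  -- `(X ⊗ (W₁ ⊗_∞ W₂))^{Z × Y}` and `((X ⊗ (W₁ ⊗_∞ W₂))^Y)^Z` to `(X^Y ⊗ (W₁ ⊗_∞ W₂))^Z`.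
  let E := ((((Prolong.mapEquiv W₂.ideal (e₁.postcomp Z)).trans
    (Prolong.mapEquiv W₂.ideal (SmoothEquiv.curry (Prolong X W₁.ideal) Y Z))).trans
    ⟨Φ, Ψ, hl, hr⟩).trans (SmoothEquiv.curry _ Y Z).symm).trans (e.symm.postcomp Z)
  refine ⟨E.hom, E.inv, E.left_inv, E.right_inv, fun F G hG z => e.injective ?_⟩
  refine (e.right_inv _).trans (SmoothMap.ext (funext fun y => ?_))
  refine Eq.trans ?_ (he _ y).symm
  refine hΦ ⟨fun q => F (q.1, q.2.1) q.2.2, (F.smooth.comp (isSmooth_fst.prodMk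
    (isSmooth_fst.comp isSmooth_snd))).apply (isSmooth_snd.comp isSmooth_snd)⟩
    ((SmoothEquiv.curry _ Y Z).hom.comp ((e₁.postcomp Z).hom.comp G)) (fun b p => ?_) (z, y)
  change e₁.hom (G b p.1) p.2 = _
  rw [hG, he₁]
  rfl

/-! ## The category `D` -/

section CategoryD

variable {C C' C'' : CatD}

theorem DObj.op_toRing (C : DObj) {n : ℕ} (f : Cinf n) (a : Fin n → Cinf (C.dim + C.weil.gens)) :
    C.ring.op f (fun i => C.toRing (a i)) = C.toRing (Cinf.subst f a) :=
  CinfRing.quot_op_mk (CinfRing.free _) _ f a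

/-- The ring is generated by the coordinates, so lifts of their images serve as the components of
`u`. -/
theorem exists_represents (φ : C ⟶ C') : ∃ u, Represents φ u := by
  choose u hu using fun i : Fin C.gens =>
    Quotient.exists_rep (φ.hom.toFun (DObj.toRing C (Cinf.coord i)))
  refine ⟨⟨fun x i => (u i).1 x, isSmooth_pi fun i => (u i).2⟩, fun f => ?_⟩
  have h1 : DObj.toRing C f = (DObj.ring C).op f (fun i => DObj.toRing C (Cinf.coord i)) :=
    (DObj.op_toRing C f Cinf.coord).symm
  rw [h1, φ.hom.map_op]
  simp only [← hu]
  exact DObj.op_toRing C' f _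

/-- Equality of classes after pullback along `u` is a congruence on the free ring, so it contains
the generated congruence once it contains the generators. -/
theorem exists_hom_of_toRing_eq (u : SmoothMap (Fin C'.gens → ℝ) (Fin C.gens → ℝ))
    (h : ∀ f ∈ (DObj.weil C).ideal,
      DObj.toRing C' (Cinf.pullback u (Cinf.inr _ _ f)) = DObj.toRing C' 0) :
    ∃ φ : C ⟶ C', Represents φ u := by
  have hop : ∀ {n : ℕ} (f : Cinf n) (a : Fin n → Cinf C.gens),
      DObj.toRing C' (Cinf.pullback u (Cinf.subst f a)) =
        (DObj.ring C').op f (fun i => DObj.toRing C' (Cinf.pullback u (a i))) := fun f a =>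
    (DObj.op_toRing C' f fun i => Cinf.pullback u (a i)).symm
  refine ⟨⟨⟨Quotient.lift (fun f => DObj.toRing C' (Cinf.pullback u f)) fun a b hab =>
    hab (fun a b => DObj.toRing C' (Cinf.pullback u a) = DObj.toRing C' (Cinf.pullback u b))
      ⟨⟨fun _ => rfl, Eq.symm, Eq.trans⟩, fun f a b hi => ?_⟩ ?_, fun f q => ?_⟩⟩, fun f => rfl⟩
  · refine (hop f a).trans (Eq.trans ?_ (hop f b).symm)
    simp only [hi]
  · rintro a b ⟨rfl, f, hf, rfl⟩
    exact h f hf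
  · choose a ha using fun i => Quotient.exists_rep (q i)
    obtain rfl : (fun i => Quotient.mk _ (a i)) = q := funext ha
    refine (congrArg _ (DObj.op_toRing C f a)).trans ?_
    exact hop f a

theorem Represents.comp {φ : C ⟶ C'} {ψ : C' ⟶ C''} {u : SmoothMap (Fin C'.gens → ℝ) (Fin C.gens → ℝ)}
    {v : SmoothMap (Fin C''.gens → ℝ) (Fin C'.gens → ℝ)} (hu : Represents φ u)
    (hv : Represents ψ v) : Represents (φ ≫ ψ) (u.comp v) := fun f =>
  (congrArg ψ.hom.toFun (hu f)).trans (hv _)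

theorem Represents.of_eq {φ : C ⟶ C'} {u v : SmoothMap (Fin C'.gens → ℝ) (Fin C.gens → ℝ)}
    (hu : Represents φ u) (h : ∀ x, u x = v x) : Represents φ v := by
  rwa [show v = u from SmoothMap.ext (funext fun x => (h x).symm)]

theorem Represents.hom_ext {φ ψ : C ⟶ C'} {u : SmoothMap (Fin C'.gens → ℝ) (Fin C.gens → ℝ)}
    (hφ : Represents φ u) (hψ : Represents ψ u) : φ = ψ := by
  refine InducedCategory.hom_ext (CinfRing.Hom.ext (funext fun q => ?_))
  induction q using Quotient.ind with | _ f
  exact (hφ f).trans (hψ f).symm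

theorem toRing_inr_of_mem {f : Cinf (DObj.weil C).gens} (hf : f ∈ (DObj.weil C).ideal) :
    DObj.toRing C (Cinf.inr (DObj.dim C) _ f) = DObj.toRing C 0 :=
  Quotient.sound fun _ _ h => h _ _ ⟨rfl, f, hf, rfl⟩

/-- The object `C^∞(ℝⁿ) ⊗_∞ W` of `D`. -/
abbrev CatD.of (n : ℕ) (W : WeilAlgebra) : CatD := (⟨n, W⟩ : DObj)

/-- The projection `ℝ^{m+n} → ℝᵐ`. -/
def projLeft (m n : ℕ) : SmoothMap (Fin (m + n) → ℝ) (Fin m → ℝ) :=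
  ⟨fun x i => x (Fin.castAdd n i), isSmooth_pi fun _ => isSmooth_eval _⟩

/-- The projection `ℝ^{m+n} → ℝⁿ`. -/
def projRight (m n : ℕ) : SmoothMap (Fin (m + n) → ℝ) (Fin n → ℝ) :=
  ⟨fun x i => x (Fin.natAdd m i), isSmooth_pi fun _ => isSmooth_eval _⟩

theorem projLeft_append {m n : ℕ} (a : Fin m → ℝ) (b : Fin n → ℝ) :
    projLeft m n (Fin.append a b) = a := funext fun i => Fin.append_left a b i

theorem projRight_append {m n : ℕ} (a : Fin m → ℝ) (b : Fin n → ℝ) :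
    projRight m n (Fin.append a b) = b := funext fun i => Fin.append_right a b i

theorem append_proj {m n : ℕ} (x : Fin (m + n) → ℝ) :
    Fin.append (projLeft m n x) (projRight m n x) = x := Fin.append_castAdd_natAdd

/-- The map `a × ℝᵏ`. -/
def baseChangeMap {m n : ℕ} (k : ℕ) (a : SmoothMap (Fin m → ℝ) (Fin n → ℝ)) :
    SmoothMap (Fin (m + k) → ℝ) (Fin (n + k) → ℝ) :=
  ⟨fun x => Fin.append (a (projLeft m k x)) (projRight m k x),
    isSmooth_append (a.smooth.comp (projLeft m k).smooth) (projRight m k).smooth⟩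

theorem exists_represents_baseChangeMap {m n : ℕ} (W : WeilAlgebra)
    (a : SmoothMap (Fin m → ℝ) (Fin n → ℝ)) :
    ∃ φ : CatD.of n W ⟶ CatD.of m W, Represents φ (baseChangeMap W.gens a) :=
  exists_hom_of_toRing_eq (C := CatD.of n W) (C' := CatD.of m W) _ fun f hf => by
    refine Eq.trans (congrArg _ (Subtype.ext (funext fun x => ?_)))
      (toRing_inr_of_mem (C := CatD.of m W) hf)
    exact congrArg f.1 (projRight_append _ _)

/-- The morphism `a^* ⊗ W : C^∞(ℝⁿ) ⊗ W → C^∞(ℝᵐ) ⊗ W`. -/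
noncomputable def baseChange {m n : ℕ} (W : WeilAlgebra)
    (a : SmoothMap (Fin m → ℝ) (Fin n → ℝ)) : CatD.of n W ⟶ CatD.of m W :=
  (exists_represents_baseChangeMap W a).choose

theorem represents_baseChange {m n : ℕ} (W : WeilAlgebra)
    (a : SmoothMap (Fin m → ℝ) (Fin n → ℝ)) :
    Represents (baseChange W a) (baseChangeMap W.gens a) :=
  (exists_represents_baseChangeMap W a).choose_spec

/-- Evaluation at a point, `C^∞(ℝⁿ) ⊗ W → W`. -/
noncomputable def pointHom {n : ℕ} (W : WeilAlgebra) (a : Fin n → ℝ) :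
    CatD.of n W ⟶ CatD.of 0 W := baseChange W ⟨fun _ => a, isSmooth_const a⟩

theorem baseChange_comp_pointHom {m n : ℕ} (W : WeilAlgebra)
    (a : SmoothMap (Fin m → ℝ) (Fin n → ℝ)) (s : Fin m → ℝ) :
    baseChange W a ≫ pointHom W s = pointHom W (a s) := by
  refine (((represents_baseChange W a).comp (represents_baseChange W _)).of_eq
    fun x => ?_).hom_ext (represents_baseChange W _)
  change Fin.append (a (projLeft _ _ (Fin.append _ _))) (projRight _ _ (Fin.append _ _)) =
    Fin.append _ _
  rw [projLeft_append, projRight_append]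

/-- Every morphism `C^∞(ℝⁿ) ⊗ W → C^∞(ℝᵐ) ⊗ W'` factors over `C^∞(ℝ^{m+l}) ⊗ W`. -/
theorem exists_factorization (φ : C ⟶ C') (u : SmoothMap (Fin C'.gens → ℝ) (Fin C.gens → ℝ))
    (hu : Represents φ u) : ∃ ψ : CatD.of C'.gens (DObj.weil C) ⟶ C',
      baseChange (DObj.weil C) ((projLeft _ _).comp u) ≫ ψ = φ ∧
      Represents ψ ⟨fun x => Fin.append x (projRight _ _ (u x)),
        isSmooth_append isSmooth_id ((projRight _ _).smooth.comp u.smooth)⟩ := by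
  -- All generators of `C'`, the nilpotent ones included, become free parameters, and `ψ` is the
  -- identity on them. The relations of `W` are respected because `φ` respects them.
  obtain ⟨ψ, hψ⟩ := exists_hom_of_toRing_eq (C := CatD.of C'.gens (DObj.weil C)) (C' := C')
    ⟨fun x => Fin.append x (projRight _ _ (u x)),
        isSmooth_append isSmooth_id ((projRight _ _).smooth.comp u.smooth)⟩ fun f hf => by
    have h1 := congrArg φ.hom.toFun (toRing_inr_of_mem hf)
    rw [hu, hu] at h1
    refine Eq.trans (congrArg _ (Subtype.ext (funext fun x => ?_))) h1
    exact congrArg f.1 (projRight_append _ _)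
  refine ⟨ψ, ?_, hψ⟩
  refine (((represents_baseChange _ _).comp hψ).of_eq fun x => ?_).hom_ext hu
  change Fin.append (projLeft _ _ (u (projLeft _ _ (Fin.append _ _))))
    (projRight _ _ (Fin.append _ _)) = u x
  rw [projLeft_append, projRight_append, append_proj]

end CategoryD

/-! ### Evaluation and point values of prolongations -/

namespace Prolong

variable {X : Type u} {Y : Type v} {Z : Type w} [Frolicher X] [Frolicher Y] [Frolicher Z]

/-- The arguments are replaced one at a time. The other argument still depends on `x`, so
`graphComp_sub_mem` is needed rather than the bare relation. -/
theorem modSetoid_map₂ (W : WeilAlgebra) (m : SmoothMap (X × Y) Z)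
    {f f' : SmoothMap (Fin W.gens → ℝ) X} (hf : (modSetoid X W.ideal).r f f')
    {g g' : SmoothMap (Fin W.gens → ℝ) Y} (hg : (modSetoid Y W.ideal).r g g') :
    (modSetoid Z W.ideal).r (m.comp (f.prodMk g)) (m.comp (f'.prodMk g')) := by
  refine ⟨?_, fun χ => ?_⟩
  · change m (f 0, g 0) = m (f' 0, g' 0)
    rw [hf.1, hg.1]
  · have h1 := Cinf.graphComp_sub_mem W hf ⟨fun p => χ (m (p.1, g p.2)),
      χ.smooth.comp (m.smooth.comp (isSmooth_fst.prodMk (g.smooth.comp isSmooth_snd)))⟩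
    have h2 := Cinf.graphComp_sub_mem W hg ⟨fun p => χ (m (f' p.2, p.1)),
      χ.smooth.comp (m.smooth.comp ((f'.smooth.comp isSmooth_snd).prodMk isSmooth_fst))⟩
    have h3 := add_mem h1 h2
    convert h3 using 1
    exact (sub_add_sub_cancel _ _ _).symm

/-- The map `X ⊗ W × Y ⊗ W → Z ⊗ W` induced by a smooth map `X × Y → Z`. -/
def map₂ (W : WeilAlgebra) (m : SmoothMap (X × Y) Z) :
    Prolong X W.ideal → Prolong Y W.ideal → Prolong Z W.ideal :=
  Quotient.map₂ (fun f g => m.comp (f.prodMk g)) fun _ _ hf _ _ hg => modSetoid_map₂ W m hf hg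

end Prolong

namespace ProlongD

variable {X : Type u} {Y : Type v} [Frolicher X] [Frolicher Y]

/-- Cartesian closedness supplies a joint representative, so the substitution formula determines the
action of every morphism. -/
theorem mk_surjective (C : CatD) (q : ProlongD X C) : ∃ F, mk C F = q := by
  induction q using Quotient.ind with | _ f
  refine ⟨⟨fun z => f (projRight _ _ z) (projLeft _ _ z),
    (f.smooth.comp (projRight _ _).smooth).apply (projLeft _ _).smooth⟩, ?_⟩
  refine congrArg (Prolong.mk _) (SmoothMap.ext (funext fun t => SmoothMap.ext (funext fun a => ?_)))
  change f (projRight _ _ (Fin.append a t)) (projLeft _ _ (Fin.append a t)) = f t a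
  rw [projLeft_append, projRight_append]

/-- Evaluation `X^Y ⊗ C × Y ⊗ C → X ⊗ C`. -/
def ev (C : CatD) : ProlongD (SmoothMap Y X) C → ProlongD Y C → ProlongD X C :=
  Prolong.map₂ (DObj.weil C) ⟨fun p => ⟨fun a => p.1 a (p.2 a),
      (p.1.smooth).apply p.2.smooth⟩, isSmooth_of_uncurry
    (((isSmooth_fst.comp isSmooth_fst).apply isSmooth_snd).apply
      ((isSmooth_snd.comp isSmooth_fst).apply isSmooth_snd))⟩

theorem ev_mk (C : CatD) (H : SmoothMap (Fin C.gens → ℝ) (SmoothMap Y X))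
    (g : SmoothMap (Fin C.gens → ℝ) Y) :
    ev C (mk C H) (mk C g) = mk C ⟨fun p => H p (g p), H.smooth.apply g.smooth⟩ := rfl

/-- The value in `X ⊗ W` of an element of `X ⊗ (C^∞(ℝⁿ) ⊗ W)` at a point of `ℝⁿ`. -/
def evalPt (C : CatD) (a : Fin (DObj.dim C) → ℝ) : SmoothMap (ProlongD X C) (Prolong X (DObj.weil C).ideal) :=
  Prolong.map _ (SmoothMap.evalAt X a)

end ProlongD

section Points

open ProlongD

/-- `C^∞(ℝⁿ, X^Y) ⊗ W ≅ (X ⊗ W)^{ℝⁿ × Y}`, and a map is determined by its values. The next lemma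
uses the surjectivity of the same isomorphism. -/
theorem WeilExponentiable.prolongD_exp_ext {X : FS.{u}} (hX : WeilExponentiable X) (Y : FS.{u})
    (C : CatD) {q q' : ProlongD (SmoothMap Y X) C}
    (h : ∀ a y, Prolong.map _ (SmoothMap.evalAt X.carrier y) (evalPt C a q) =
      Prolong.map _ (SmoothMap.evalAt X.carrier y) (evalPt C a q')) : q = q' := by
  obtain ⟨e, he⟩ := hX.exists_smoothEquiv ⟨(Fin (DObj.dim C) → ℝ) × Y⟩ (DObj.weil C)
  refine (Prolong.mapEquiv _ (SmoothEquiv.curry X.carrier Y.carrier _)).injective (e.injective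
    (SmoothMap.ext (funext fun p => ?_)))
  refine (he _ p).trans (Eq.trans ?_ (he _ p).symm)
  have h1 := h p.1 p.2
  induction q using Quotient.ind
  induction q' using Quotient.ind
  exact h1

theorem WeilExponentiable.exists_prolongD_exp {X : FS.{u}} (hX : WeilExponentiable X) (Y : FS.{u})
    (C : CatD) (σ : SmoothMap ((Fin (DObj.dim C) → ℝ) × Y) (Prolong X (DObj.weil C).ideal)) :
    ∃ q : ProlongD (SmoothMap Y X) C, ∀ a y,
      Prolong.map _ (SmoothMap.evalAt X.carrier y) (evalPt C a q) = σ (a, y) := by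
  obtain ⟨e, he⟩ := hX.exists_smoothEquiv ⟨(Fin (DObj.dim C) → ℝ) × Y⟩ (DObj.weil C)
  refine ⟨(Prolong.mapEquiv _ (SmoothEquiv.curry X.carrier Y.carrier _)).inv (e.inv σ), fun a y => ?_⟩
  refine Eq.trans ?_ (congrArg (fun f => f.toFun (a, y)) (e.right_inv σ))
  refine Eq.trans ?_ (he _ _).symm
  induction e.inv σ using Quotient.ind
  rfl

/-- The case of a one-point `Y`; the constant maps embed `X` in `X^P` with evaluation at the point
as retraction. -/
theorem WeilExponentiable.prolongD_ext {X : FS.{u}} (hX : WeilExponentiable X)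
    (C : CatD) {q q' : ProlongD X C} (h : ∀ a, evalPt C a q = evalPt C a q') : q = q' := by
  obtain ⟨P, ⟨p⟩⟩ : ∃ P : FS.{u}, Nonempty P := ⟨@FS.mk PUnit (ofFunctions ∅), ⟨⟨⟩⟩⟩
  let κ : SmoothMap X (SmoothMap P X) := ⟨fun x => ⟨fun _ => x, isSmooth_const x⟩,
    isSmooth_of_uncurry isSmooth_fst⟩
  have h1 : ProlongD.map C κ q = ProlongD.map C κ q' := by
    refine hX.prolongD_exp_ext P C fun a y => ?_
    have h2 := h a
    induction q using Quotient.ind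
    induction q' using Quotient.ind
    exact h2
  have h3 := congrArg (ProlongD.map C (SmoothMap.evalAt X.carrier p)) h1
  rw [← ProlongD.map_comp, ← ProlongD.map_comp] at h3
  exact (ProlongD.map_id C q).symm.trans (h3.trans (ProlongD.map_id C q'))

namespace ProlongationBifunctor

variable (T : ProlongationBifunctor.{u})

/-- Point values are thus given by morphisms of `D`, so natural transformations must respect them.
-/
theorem evalPt_pointHom (X : FSWE.{u}) {n : ℕ} (W : WeilAlgebra) (a : Fin n → ℝ)
    (q : ProlongD X.obj (CatD.of n W)) :
    evalPt (CatD.of 0 W) 0 (T.act X (pointHom W a) q) = evalPt (CatD.of n W) a q := by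
  obtain ⟨F, rfl⟩ := mk_surjective _ q
  rw [pointHom, T.act_mk X _ _ (represents_baseChange W _)]
  refine congrArg (Prolong.mk _) (SmoothMap.ext (funext fun t => congrArg F.toFun ?_))
  change Fin.append a (projRight _ _ (Fin.append 0 t)) = Fin.append a t
  rw [projRight_append]

end ProlongationBifunctor

end Points

/-! ### Universal property of evaluation -/

namespace ProlongationBifunctor

open ProlongD

variable (T : ProlongationBifunctor.{u}) {X Y : FSWE.{u}}
  (hXY : WeilExponentiable (FS.exp X.obj Y.obj))

/-- Evaluation is natural in `C`. -/
theorem act_ev {C C' : CatD} (φ : C ⟶ C') (q : ProlongD (SmoothMap Y.obj X.obj) C)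
    (p : ProlongD Y.obj C) :
    T.act X φ (ev C q p) = ev C' (T.act ⟨FS.exp X.obj Y.obj, hXY⟩ φ q) (T.act Y φ p) := by
  obtain ⟨u, hu⟩ := exists_represents φ
  obtain ⟨H, rfl⟩ := mk_surjective C q
  obtain ⟨g, rfl⟩ := mk_surjective C p
  rw [ev_mk, T.act_mk X φ u hu, T.act_mk Y φ u hu]
  refine Eq.trans ?_ (congrArg (fun q => ev C' q _)
    (T.act_mk ⟨FS.exp X.obj Y.obj, hXY⟩ φ u hu H).symm)
  rfl

theorem evalPt_ev {n : ℕ} (W : WeilAlgebra) (q : ProlongD (SmoothMap Y.obj X.obj) (CatD.of n W))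
    (a : Fin n → ℝ) (y : Y.obj) :
    evalPt (CatD.of n W) a (ev (CatD.of n W) q (ProlongD.mk (CatD.of n W) ⟨fun _ => y, isSmooth_const y⟩)) =
      Prolong.map _ (SmoothMap.evalAt X.obj.carrier y) (evalPt (CatD.of n W) a q) := by
  induction q using Quotient.ind
  rfl

/-- An element of `X^Y ⊗ C` is determined by its action on the elements of `Y`. -/
theorem ev_act_injective {C : CatD} {q q' : ProlongD (SmoothMap Y.obj X.obj) C}
    (h : ∀ (C' : CatD) (φ : C ⟶ C') (p : ProlongD Y.obj C'),
      ev C' (T.act ⟨FS.exp X.obj Y.obj, hXY⟩ φ q) p =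
        ev C' (T.act ⟨FS.exp X.obj Y.obj, hXY⟩ φ q') p) : q = q' := by
  refine X.property.prolongD_exp_ext Y.obj C fun a y => ?_
  -- Point morphisms and constant elements of `Y` suffice as tests.
  have h1 := congrArg (evalPt (CatD.of 0 (DObj.weil C)) 0) (h _ (pointHom (DObj.weil C) a)
    (ProlongD.mk _ ⟨fun _ => y, isSmooth_const y⟩))
  rw [evalPt_ev, evalPt_ev] at h1
  have h2 := T.evalPt_pointHom ⟨FS.exp X.obj Y.obj, hXY⟩ (DObj.weil C) a q
  have h3 := T.evalPt_pointHom ⟨FS.exp X.obj Y.obj, hXY⟩ (DObj.weil C) a q'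
  exact ((congrArg _ h2).symm.trans h1).trans (congrArg _ h3)

section Representation

variable {F : CatD → Type u} (Fmap : ∀ {C C' : CatD}, (C ⟶ C') → F C → F C')

/-- Naturality under the morphism of the point `s`: the left side depends on `a` and `g` only
through `a s` and `g s`. It is used both for the given `θ` and for evaluation itself. -/
theorem evalPt_baseChange
    (hF : ∀ {C C' C'' : CatD} (φ : C ⟶ C') (ψ : C' ⟶ C'') (x : F C),
      Fmap (φ ≫ ψ) x = Fmap ψ (Fmap φ x))
    (θ : ∀ C : CatD, ProlongD Y.obj C → F C → ProlongD X.obj C)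
    (hθ : ∀ {C C' : CatD} (φ : C ⟶ C') (p : ProlongD Y.obj C) (x : F C),
      T.act X φ (θ C p x) = θ C' (T.act Y φ p) (Fmap φ x))
    {C : CatD} (x : F C) {m : ℕ}
    (a : SmoothMap (Fin m → ℝ) (Fin (DObj.dim C) → ℝ)) (g : SmoothMap (Fin m → ℝ) Y.obj)
    (s : Fin m → ℝ) :
    evalPt (CatD.of m (DObj.weil C)) s (θ _ (ProlongD.mk _ (g.comp (projLeft _ _)))
      (Fmap (baseChange (DObj.weil C) a) x)) =
    evalPt (CatD.of 0 (DObj.weil C)) 0 (θ _ (ProlongD.mk _ ⟨fun _ => g s, isSmooth_const _⟩)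
      (Fmap (pointHom (DObj.weil C) (a s)) x)) := by
  have h1 : T.act Y (pointHom (DObj.weil C) s) (ProlongD.mk (CatD.of m (DObj.weil C))
      (g.comp (projLeft _ _))) = ProlongD.mk _ ⟨fun _ => g s, isSmooth_const _⟩ := by
    refine (T.act_mk Y (C := CatD.of m (DObj.weil C)) (C' := CatD.of 0 (DObj.weil C))
      (pointHom (DObj.weil C) s) (baseChangeMap _ ⟨fun _ => s, isSmooth_const s⟩)
      (represents_baseChange (DObj.weil C) _) _).trans ?_
    refine congrArg (ProlongD.mk _) (SmoothMap.ext (funext fun x => congrArg g.toFun ?_))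
    refine (congrArg (projLeft _ _).toFun ?_).trans (projLeft_append s (projRight _ _ x))
    rfl
  rw [← T.evalPt_pointHom, hθ, ← hF, baseChange_comp_pointHom, h1]

theorem exists_ev_eq
    (hF : ∀ {C C' C'' : CatD} (φ : C ⟶ C') (ψ : C' ⟶ C'') (x : F C),
      Fmap (φ ≫ ψ) x = Fmap ψ (Fmap φ x))
    (θ : ∀ C : CatD, ProlongD Y.obj C → F C → ProlongD X.obj C)
    (hθ : ∀ {C C' : CatD} (φ : C ⟶ C') (p : ProlongD Y.obj C) (x : F C),
      T.act X φ (θ C p x) = θ C' (T.act Y φ p) (Fmap φ x))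
    {C : CatD} (x : F C) :
    ∃ q : ProlongD (SmoothMap Y.obj X.obj) C, ∀ (C' : CatD) (φ : C ⟶ C') (p : ProlongD Y.obj C'),
      ev C' (T.act ⟨FS.exp X.obj Y.obj, hXY⟩ φ q) p = θ C' p (Fmap φ x) := by
  have hpt := fun {m : ℕ} => evalPt_baseChange T Fmap hF θ hθ x (m := m)
  -- The map `σ`. Along a curve its values are the point values of one element over `C^∞(ℝ) ⊗_∞ W`,
  -- and a representative `f` of that element shows them to vary smoothly.
  have hσ : IsSmooth fun z : (Fin (DObj.dim C) → ℝ) × Y.obj =>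
      evalPt (CatD.of 0 (DObj.weil C)) 0 (θ _ (ProlongD.mk _ ⟨fun _ => z.2, isSmooth_const _⟩)
        (Fmap (pointHom (DObj.weil C) z.1) x)) := by
    intro γ hγ
    let a : SmoothMap (Fin 1 → ℝ) (Fin (DObj.dim C) → ℝ) := ⟨fun s => (γ (s 0)).1,
      IsSmooth.comp (g := Prod.fst ∘ γ) (isSmooth_of_mem_curves hγ.1) (isSmooth_eval 0)⟩
    let g : SmoothMap (Fin 1 → ℝ) Y.obj := ⟨fun s => (γ (s 0)).2,
      IsSmooth.comp (g := Prod.snd ∘ γ) (isSmooth_of_mem_curves hγ.2) (isSmooth_eval 0)⟩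
    have h1 := hpt a g
    obtain ⟨f, hf⟩ := Quotient.exists_rep (θ (CatD.of 1 (DObj.weil C))
      (ProlongD.mk _ (g.comp (projLeft _ _))) (Fmap (baseChange (DObj.weil C) a) x))
    have h2 : IsSmooth fun s : ℝ => Prolong.mk (DObj.weil C).ideal
        (⟨fun t => f t (fun _ => s), f.smooth.apply (isSmooth_const _)⟩ :
          SmoothMap (Fin (DObj.weil C).gens → ℝ) X.obj) :=
      Prolong.isSmooth_mk (DObj.weil C) (isSmooth_of_uncurry
        ((f.smooth.comp isSmooth_snd).apply (isSmooth_pi fun _ => isSmooth_fst)))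
    convert h2 _root_.id (show ContDiff ℝ ∞ (_root_.id : ℝ → ℝ) from contDiff_id) using 1
    funext s
    refine (h1 fun _ => s).symm.trans ?_
    rw [← hf]
    rfl
  obtain ⟨q, hq⟩ := X.property.exists_prolongD_exp Y.obj C ⟨_, hσ⟩
  refine ⟨q, fun C' φ p => ?_⟩
  obtain ⟨u, hu⟩ := exists_represents φ
  obtain ⟨ψ, hψ, hψ'⟩ := exists_factorization φ u hu
  obtain ⟨g, rfl⟩ := mk_surjective C' p
  -- The given element of `Y ⊗ C'` lifts along `ψ`, so naturality reduces the claim to a base change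
  -- over the same `W`.
  have hg : ProlongD.mk C' g = T.act Y ψ (ProlongD.mk _ (g.comp (projLeft _ _))) := by
    rw [T.act_mk Y ψ _ hψ']
    refine congrArg (ProlongD.mk C') (SmoothMap.ext (funext fun x => congrArg g.toFun ?_))
    exact (projLeft_append _ _).symm
  rw [hg, ← hψ, hF, ← hθ, T.act_comp, ← T.act_ev hXY]
  congr 1
  -- At the point `s` both sides become `σ` at the left part of `u s` and `g s`.
  refine X.property.prolongD_ext _ fun s => ?_
  refine Eq.trans ?_ (hpt _ g s).symm
  have h3 := evalPt_baseChange T (F := fun C => ProlongD (SmoothMap Y.obj X.obj) C)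
    (fun φ => (T.act ⟨FS.exp X.obj Y.obj, hXY⟩ φ).toFun)
    (fun φ ψ x => T.act_comp ⟨FS.exp X.obj Y.obj, hXY⟩ φ ψ x)
    (fun C p q => ev C q p) (fun φ p x => T.act_ev hXY φ x p) q ((projLeft _ _).comp u) g s
  refine h3.trans ?_
  rw [evalPt_ev]
  refine Eq.trans (congrArg _ ?_) (hq _ (g s))
  exact T.evalPt_pointHom ⟨FS.exp X.obj Y.obj, hXY⟩ (DObj.weil C) _ q

end Representation

/-- Evaluation, as a natural transformation `J(Y) × J(X^Y) → J(X)`. -/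
def evNat : T.J.obj Y ⊗ T.J.obj ⟨FS.exp X.obj Y.obj, hXY⟩ ⟶ T.J.obj X where
  app C := ↾(fun p : ProlongD Y.obj C × ProlongD (SmoothMap Y.obj X.obj) C => ev C p.2 p.1)
  naturality C C' φ := by
    ext p
    exact (T.act_ev hXY φ p.2 p.1).symm

theorem exists_whiskerLeft_comp_evNat {F : CatD ⥤ Type u} (θ : T.J.obj Y ⊗ F ⟶ T.J.obj X) :
    ∃ h : F ⟶ T.J.obj ⟨FS.exp X.obj Y.obj, hXY⟩, T.J.obj Y ◁ h ≫ T.evNat hXY = θ := by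
  choose q hq using fun (C : CatD) (x : F.obj C) => T.exists_ev_eq hXY (fun φ => F.map φ)
    (fun φ ψ x => by simp)
    (fun C p x => θ.app C ((p, x) : (T.J.obj Y).obj C × F.obj C)) (fun φ p x => by
      exact (ConcreteCategory.congr_hom (θ.naturality φ)
        (show (T.J.obj Y ⊗ F).obj _ from ((p, x) : (T.J.obj Y).obj _ × F.obj _))).symm) x
  refine ⟨{ app := fun C => ↾(q C), naturality := fun C C' φ => ?_ }, ?_⟩
  · ext x
    -- Naturality comes for free: both elements act on all `p` through `θ` in the same way.
    refine T.ev_act_injective hXY fun C'' ψ p => ?_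
    refine (hq C' (F.map φ x) C'' ψ p).trans ?_
    refine Eq.trans ?_ ((hq C x C'' (φ ≫ ψ) p).symm.trans ?_)
    · rw [Functor.map_comp]
      rfl
    · rw [T.act_comp]
      rfl
  · ext C p
    have h1 := hq C p.2 C (𝟙 C) p.1
    rw [T.act_id] at h1
    refine h1.trans ?_
    rw [CategoryTheory.Functor.map_id]
    rfl

theorem eq_of_whiskerLeft_comp_evNat_eq {F : CatD ⥤ Type u}
    {h h' : F ⟶ T.J.obj ⟨FS.exp X.obj Y.obj, hXY⟩}
    (e : T.J.obj Y ◁ h ≫ T.evNat hXY = T.J.obj Y ◁ h' ≫ T.evNat hXY) : h = h' := by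
  ext C x
  refine T.ev_act_injective hXY fun C' φ p => ?_
  have h1 := ConcreteCategory.congr_hom (NatTrans.congr_app e C')
    (show (T.J.obj Y ⊗ F).obj C' from ((p, F.map φ x) : (T.J.obj Y).obj C' × F.obj C'))
  have h2 : h.app C' (F.map φ x) = T.act ⟨FS.exp X.obj Y.obj, hXY⟩ φ (h.app C x) :=
    ConcreteCategory.congr_hom (h.naturality φ) x
  have h3 : h'.app C' (F.map φ x) = T.act ⟨FS.exp X.obj Y.obj, hXY⟩ φ (h'.app C x) :=
    ConcreteCategory.congr_hom (h'.naturality φ) x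
  exact ((congrArg (fun q => ev C' q p) h2).symm.trans h1).trans (congrArg (fun q => ev C' q p) h3)

/-- Factoring the counit of the internal hom through evaluation gives the inverse. One composite is
the identity by the uniqueness of factorizations, the other by transposition. -/
theorem isIso_curry_evNat : IsIso (MonoidalClosed.curry (T.evNat hXY)) := by
  obtain ⟨h, hh⟩ := T.exists_whiskerLeft_comp_evNat hXY ((ihom.ev (T.J.obj Y)).app (T.J.obj X))
  refine ⟨h, T.eq_of_whiskerLeft_comp_evNat_eq hXY ?_, ?_⟩
  · rw [MonoidalCategory.whiskerLeft_comp, Category.assoc, hh, ← MonoidalClosed.uncurry_eq,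
      MonoidalClosed.uncurry_curry, MonoidalCategory.whiskerLeft_id, Category.id_comp]
  · rw [← MonoidalClosed.curry_natural_left, hh, ← MonoidalClosed.uncurry_id_eq_ev,
      MonoidalClosed.curry_uncurry]

end ProlongationBifunctor

theorem proposition5p3 (T : ProlongationBifunctor.{u}) (X Y : FSWE.{u}) :
    ∃ (hXY : WeilExponentiable (FS.exp X.obj Y.obj))
      (e : T.J.obj ⟨FS.exp X.obj Y.obj, hXY⟩ ≅ (ihom (T.J.obj Y)).obj (T.J.obj X)),
      ∀ (C : CatD) (H : SmoothMap ((Fin C.gens → ℝ) × Y.obj) X.obj)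
        (g : SmoothMap (Fin C.gens → ℝ) Y.obj),
        (MonoidalClosed.uncurry e.hom).app C
            ((ProlongD.mk C g, ProlongD.mk C H.curry) :
              ProlongD Y.obj C × ProlongD (SmoothMap Y.obj X.obj) C) =
          ProlongD.mk C (H.comp ((SmoothMap.id _).prodMk g)) := by
  refine ⟨X.property.exp Y.obj,
    @asIso _ _ _ _ _ (T.isIso_curry_evNat (X.property.exp Y.obj)), fun C H g => ?_⟩
  rw [asIso_hom, MonoidalClosed.uncurry_curry]
  rfl
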